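/- Let $\mathscr C=(\mathbb C^4\setminus 0)/U(1)\cong\mathbb R^+\times\mathbb{CP}^3$, where $U(1)$ acts by scalar multiplication. On $\mathbb C^4=\mathbb H^2$ (with $q_0=z_0+jz_1$, $q_1=z_2+jz_3$) let $R=\|\mathbf z\|^2$ and let $\hat\alpha_m=R^{-1}\,Y_m\lrcorner e$, where $e$ is the Euclidean metric and $Y_1,Y_2,Y_3$ are the vector fields generated by right multiplication by $i,j,k$. Give $\mathscr C$ the conical $G_2$ structure whose 3-form $\varphi$ pulls back to $\mathbb C^4\setminus0$ as $d(\tfrac13R^3\omega)$, where $\omega=d\hat\alpha_1+3\,\hat\alpha_2\wedge\hat\alpha_3$. Consider the functions on $\mathscr C$ $$f_+=z_0\bar z_3-\bar z_1z_2,\qquad a=2|f_+|^2,\qquad b=u^2-v^2,\qquad t=\arg f_+\in[0,2\pi),\qquad s=\frac{|\mathbf u+\mathbf v|}{u+v},$$ where $\mathbf u=(|z_0|^2-|z_2|^2,\ 2\,\mathrm{Re}\,z_0\bar z_2,\ -2\,\mathrm{Im}\,z_0\bar z_2)$, $\mathbf v=(|z_1|^2-|z_3|^2,\ 2\,\mathrm{Re}\,z_1\bar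 z_3,\ 2\,\mathrm{Im}\,z_1\bar z_3)$, $u=|\mathbf u|$, $v=|\mathbf v|$; one has $R=u+v$, and $s=1$ exactly where $f_+=0$, so that $t$ is defined where $s<1$. **Theorem.** Let $a_0\ge0$, $b_0\in\mathbb R$ and $t_0\in[0,2\pi)$. The set of points of $\mathscr C$ at which $a=a_0$, $b=b_0$ and, if $s<1$, also $t=t_0$, is a non-empty coassociative submanifold of $\mathscr C$ (an embedded submanifold of dimension 4 to which $\varphi$ pulls back as zero). If $(a_0,b_0)\ne(0,0)$, it is diffeomorphic to the total space of the tangent bundle $TS^2$. -/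

import Mathlib

open scoped Manifold ContDiff Topology

noncomputable section

namespace G2Cone

/-! ### The cone over complex projective 3-space as a smooth manifold -/

/-- The space `ℂ⁴ = ℝ⁸ = ℍ²`, with `q₀ = z₀ + j z₁` and `q₁ = z₂ + j z₃`. -/
abbrev C4 : Type := Fin 4 → ℂ

/-- The model vector space `ℝ × ℂ³`, of real dimension 7. -/
abbrev Model : Type := ℝ × (Fin 3 → ℂ)

/-- Two nonzero vectors are identified when they differ by a unit complex number. -/
def phaseSetoid : Setoid {z : C4 // z ≠ 0} where
  r z w := ∃ c : Circle, w.1 = (c : ℂ) • z.1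
  iseqv :=
    { refl := fun z => ⟨1, by simp⟩
      symm := by
        rintro z w ⟨c, h⟩
        exact ⟨c⁻¹, by rw [h, smul_smul]; simp⟩
      trans := by
        rintro z w y ⟨c, h⟩ ⟨d, k⟩
        exact ⟨d * c, by rw [k, h, smul_smul]; simp⟩ }

/-- The cone `𝒞 = (ℂ⁴ ∖ 0) / U(1) ≅ ℝ⁺ × ℂℙ³`, with the quotient topology. -/
def Cone : Type := Quotient phaseSetoid

instance : TopologicalSpace Cone :=
  inferInstanceAs (TopologicalSpace (Quotient phaseSetoid))

/-- The quotient map on nonzero vectors. -/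
def toCone (z : {z : C4 // z ≠ 0}) : Cone := Quotient.mk phaseSetoid z

lemma toCone_surjective : Function.Surjective toCone := Quotient.mk_surjective

lemma isQuotientMap_toCone : Topology.IsQuotientMap toCone := isQuotientMap_quotient_mk'

/-- The quotient map `ρ`, extended by an irrelevant value at `0`. -/
def proj (z : C4) : Cone :=
  if h : z ≠ 0 then toCone ⟨z, h⟩ else toCone ⟨fun _ => 1, fun h => one_ne_zero (congrFun h 0)⟩

/-- The map on the cone induced by a map on `ℂ⁴` that is invariant under unit scalars. -/
def descend {X : Type} (F : C4 → X) (hF : ∀ (c : Circle) (z : C4), F ((c : ℂ) • z) = F z) :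
    Cone → X :=
  Quotient.lift (fun z : {z : C4 // z ≠ 0} => F z.1) (by
    rintro z w ⟨c, h⟩
    rw [h, hF])

lemma descend_toCone {X : Type} (F : C4 → X) (hF) (z : {z : C4 // z ≠ 0}) :
    descend F hF (toCone z) = F z.1 := rfl

/-- The real linear inclusion `(r, ζ) ↦ z` with `zᵢ = r` and remaining coordinates `ζ`. -/
def slice (i : Fin 4) : Model →L[ℝ] C4 where
  toFun p := i.insertNth (p.1 : ℂ) p.2
  map_add' p q := by
    ext k
    refine Fin.succAboveCases i ?_ (fun j => ?_) k <;> simp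
  map_smul' c p := by
    ext k
    refine Fin.succAboveCases i ?_ (fun j => ?_) k <;> simp
  cont := by
    refine Continuous.finInsertNth i ?_ ?_ <;> fun_prop

@[simp] lemma slice_same (i : Fin 4) (p : Model) : slice i p i = p.1 := by
  simp [slice]

@[simp] lemma slice_succAbove (i : Fin 4) (p : Model) (j : Fin 3) :
    slice i p (i.succAbove j) = p.2 j := by
  simp [slice]

lemma slice_ne_zero (i : Fin 4) (p : Model) (hp : 0 < p.1) : slice i p ≠ 0 := by
  intro h
  have := congrFun h i
  simp at this
  exact hp.ne' this

/-- The coordinates `(|zᵢ|, (z̄ᵢ / |zᵢ|) zⱼ)`, `j ≠ i`. -/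
def normalise (i : Fin 4) (z : C4) : Model :=
  (‖z i‖, fun j => (starRingEnd ℂ (z i) / (‖z i‖ : ℂ)) * z (i.succAbove j))

lemma normalise_smul (i : Fin 4) (c : Circle) (z : C4) :
    normalise i ((c : ℂ) • z) = normalise i z := by
  ext j
  · simp only [normalise, Pi.smul_apply, smul_eq_mul, norm_mul, Circle.norm_coe, one_mul]
  · have hc : starRingEnd ℂ (c : ℂ) * c = 1 := by
      rw [← Complex.normSq_eq_conj_mul_self]; simp
    simp only [normalise, Pi.smul_apply, smul_eq_mul, map_mul, norm_mul, Circle.norm_coe, one_mul]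
    calc _ = (starRingEnd ℂ (c : ℂ) * c) *
          (starRingEnd ℂ (z i) / (‖z i‖ : ℂ) * z (i.succAbove j)) := by ring
      _ = _ := by rw [hc, one_mul]

lemma slice_normalise (i : Fin 4) (z : C4) (hz : z i ≠ 0) :
    slice i (normalise i z) = (starRingEnd ℂ (z i) / (‖z i‖ : ℂ)) • z := by
  have h0 : (‖z i‖ : ℂ) ≠ 0 := by simpa using hz
  ext k
  refine Fin.succAboveCases i ?_ (fun j => ?_) k
  · simp only [slice_same, normalise, Pi.smul_apply, smul_eq_mul]
    rw [div_mul_eq_mul_div, Complex.conj_mul', eq_div_iff h0]; ring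
  · simp [normalise]

lemma normalise_slice (i : Fin 4) (p : Model) (hp : 0 < p.1) :
    normalise i (slice i p) = p := by
  ext j
  · simp [normalise, abs_of_pos hp]
  · have : (p.1 : ℂ) ≠ 0 := by exact_mod_cast hp.ne'
    simp [normalise, abs_of_pos hp, this]

lemma contDiffAt_normalise (i : Fin 4) (z : C4) (hz : z i ≠ 0) :
    ContDiffAt ℝ ∞ (normalise i) z := by
  have hi : ContDiffAt ℝ ∞ (fun z : C4 => z i) z := by fun_prop
  have hn : ContDiffAt ℝ ∞ (fun z : C4 => ‖z i‖) z := hi.norm ℝ hz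
  have hn' : ContDiffAt ℝ ∞ (fun z : C4 => (‖z i‖ : ℂ)) z :=
    Complex.ofRealCLM.contDiff.contDiffAt.comp z hn
  have hc : ContDiffAt ℝ ∞ (fun z : C4 => starRingEnd ℂ (z i)) z :=
    Complex.conjCLE.contDiff.contDiffAt.comp z hi
  refine hn.prodMk (contDiffAt_pi.2 fun j => ?_)
  have hj : ContDiffAt ℝ ∞ (fun z : C4 => z (i.succAbove j)) z := by fun_prop
  have h0 : (‖z i‖ : ℂ) ≠ 0 := by simpa using hz
  simp only [div_eq_mul_inv]
  exact (hc.mul (hn'.inv h0)).mul hj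

/-- The `i`-th coordinate map of the cone. -/
def coord (i : Fin 4) : Cone → Model := descend (normalise i) (normalise_smul i)

/-- The points of the cone with `zᵢ ≠ 0`. -/
def patch (i : Fin 4) : Set Cone := {x | 0 < (coord i x).1}

lemma mem_patch_toCone (i : Fin 4) (z : {z : C4 // z ≠ 0}) : toCone z ∈ patch i ↔ z.1 i ≠ 0 := by
  change 0 < ‖z.1 i‖ ↔ _
  simp

lemma isOpen_patch (i : Fin 4) : IsOpen (patch i) := by
  rw [← isQuotientMap_toCone.isOpen_preimage]
  have : toCone ⁻¹' patch i = {z | z.1 i ≠ 0} := by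
    ext z; exact mem_patch_toCone i z
  rw [this]
  exact isOpen_ne_fun ((continuous_apply i).comp continuous_subtype_val) continuous_const

lemma proj_of_ne {z : C4} (hz : z ≠ 0) : proj z = toCone ⟨z, hz⟩ := dif_pos hz

lemma coord_proj_slice (i : Fin 4) (p : Model) (hp : 0 < p.1) :
    coord i (proj (slice i p)) = p := by
  rw [proj_of_ne (slice_ne_zero i p hp)]
  exact normalise_slice i p hp

lemma proj_slice_coord (i : Fin 4) (x : Cone) (hx : x ∈ patch i) :
    proj (slice i (coord i x)) = x := by
  obtain ⟨z, rfl⟩ := toCone_surjective x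
  have hz : z.1 i ≠ 0 := (mem_patch_toCone i z).1 hx
  rw [proj_of_ne (slice_ne_zero i _ hx)]
  have h0 : ‖z.1 i‖ ≠ 0 := by simpa using hz
  refine (Quotient.sound (s := phaseSetoid)
    ⟨⟨starRingEnd ℂ (z.1 i) / (‖z.1 i‖ : ℂ), ?_⟩, ?_⟩ : toCone z = _).symm
  · simp [Submonoid.unitSphere, h0]
  · exact slice_normalise i z.1 hz

/-- The `i`-th chart of the cone; its inverse is `ρ` restricted to the vectors with `zᵢ > 0`. -/
def chart (i : Fin 4) : OpenPartialHomeomorph Cone Model where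
  toFun := coord i
  invFun p := proj (slice i p)
  source := patch i
  target := {p | 0 < p.1}
  map_source' _ hx := hx
  map_target' p hp := by
    have hp' : 0 < p.1 := hp
    change 0 < (coord i (proj (slice i p))).1
    rwa [coord_proj_slice i p hp']
  left_inv' x hx := proj_slice_coord i x hx
  right_inv' p hp := coord_proj_slice i p hp
  open_source := isOpen_patch i
  open_target := isOpen_lt continuous_const continuous_fst
  continuousOn_toFun := by
    rw [isQuotientMap_toCone.continuousOn_isOpen_iff (isOpen_patch i)]
    intro z hz
    have hz' : z.1 i ≠ 0 := (mem_patch_toCone i z).1 hz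
    have h : ContinuousAt (fun w : {z : C4 // z ≠ 0} => normalise i w.1) z :=
      ContinuousAt.comp (g := normalise i) (contDiffAt_normalise i z.1 hz').continuousAt
        continuous_subtype_val.continuousAt
    exact h.continuousWithinAt
  continuousOn_invFun := by
    rw [continuousOn_iff_continuous_domRestrict]
    have : Set.domRestrict {p : Model | 0 < p.1} (fun p => proj (slice i p)) =
        fun p => toCone ⟨slice i p.1, slice_ne_zero i p.1 p.2⟩ := by
      ext p; exact proj_of_ne _
    rw [this]
    exact isQuotientMap_toCone.continuous.comp
      (((slice i).continuous.comp continuous_subtype_val).subtype_mk _)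

lemma exists_mem_patch (x : Cone) : ∃ i, x ∈ patch i := by
  obtain ⟨z, rfl⟩ := toCone_surjective x
  obtain ⟨i, hi⟩ := Function.ne_iff.1 z.2
  exact ⟨i, (mem_patch_toCone i z).2 hi⟩

/-- An index `i` with `zᵢ ≠ 0` at the given point. -/
def index (x : Cone) : Fin 4 := (exists_mem_patch x).choose

lemma mem_patch_index (x : Cone) : x ∈ patch (index x) := (exists_mem_patch x).choose_spec

instance : ChartedSpace Model Cone where
  atlas := Set.range chart
  chartAt x := chart (index x)
  mem_chart_source x := mem_patch_index x
  chart_mem_atlas x := ⟨index x, rfl⟩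

instance : IsManifold 𝓘(ℝ, Model) ∞ Cone := by
  refine isManifold_of_contDiffOn _ _ _ ?_
  rintro _ _ ⟨i, rfl⟩ ⟨j, rfl⟩
  simp only [modelWithCornersSelf_coe, modelWithCornersSelf_coe_symm, Function.id_comp,
    Function.comp_id, Set.range_id, Set.preimage_id, Set.inter_univ]
  have key : ∀ p ∈ ((chart i).symm.trans (chart j)).source,
      0 < p.1 ∧ (slice i p) j ≠ 0 := by
    intro p hp
    rw [OpenPartialHomeomorph.trans_source] at hp
    obtain ⟨hp1, hp2⟩ := hp
    have hp1' : 0 < p.1 := hp1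
    refine ⟨hp1', ?_⟩
    have h2 : proj (slice i p) ∈ patch j := hp2
    rw [proj_of_ne (slice_ne_zero i p hp1')] at h2
    exact (mem_patch_toCone j _).1 h2
  have hs : ContDiffOn ℝ ∞ (fun p => normalise j (slice i p))
      ((chart i).symm.trans (chart j)).source := by
    intro p hp
    exact ((contDiffAt_normalise j _ (key p hp).2).comp p
      (slice i).contDiff.contDiffAt).contDiffWithinAt
  refine hs.congr fun p hp => ?_
  change coord j (proj (slice i p)) = _
  rw [proj_of_ne (slice_ne_zero i p (key p hp).1)]
  rfl

/-! ### The `G₂` three-form -/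

/-- `R = ‖z‖²`. -/
def R (z : C4) : ℝ := ∑ i, ‖z i‖ ^ 2

/-- The vector fields generated by right multiplication by `i`, `j`, `k` on `ℍ²`. -/
def Y1 (z : C4) : C4 := fun m => Complex.I * z m

/-- See `Y1`. -/
def Y2 (z : C4) : C4 :=
  ![-starRingEnd ℂ (z 1), starRingEnd ℂ (z 0), -starRingEnd ℂ (z 3), starRingEnd ℂ (z 2)]

/-- See `Y1`. -/
def Y3 (z : C4) : C4 :=
  ![Complex.I * starRingEnd ℂ (z 1), -(Complex.I * starRingEnd ℂ (z 0)),
    Complex.I * starRingEnd ℂ (z 3), -(Complex.I * starRingEnd ℂ (z 2))]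

/-- The real linear functional `w ↦ e(y, w)`, where `e` is the Euclidean metric of `ℝ⁸`. -/
def flat (y : C4) : C4 →L[ℝ] ℝ :=
  ∑ m, (innerSL ℝ (y m)).comp (ContinuousLinearMap.proj (R := ℝ) (φ := fun _ : Fin 4 => ℂ) m)

/-- A linear functional regarded as an alternating 1-form. -/
def oneForm (l : C4 →L[ℝ] ℝ) : C4 [⋀^Fin 1]→L[ℝ] ℝ :=
  ContinuousAlternatingMap.ofSubsingleton ℝ C4 ℝ 0 l

/-- The wedge product of two linear functionals, `(l ∧ m)(v, w) = l v * m w - l w * m v`. -/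
def wedge (l m : C4 →L[ℝ] ℝ) : C4 [⋀^Fin 2]→L[ℝ] ℝ :=
  ContinuousAlternatingMap.alternatizeUncurryFin (n := 1) (l.smulRight (oneForm m))

lemma wedge_apply (l m : C4 →L[ℝ] ℝ) (v w : C4) :
    wedge l m ![v, w] = l v * m w - l w * m v := by
  simp [wedge, oneForm, ContinuousAlternatingMap.alternatizeUncurryFin_apply, Fin.sum_univ_two,
    Fin.removeNth]
  ring

/-- The normalised dual 1-form `α̂ = (Y ⌟ e) / R` of a vector field `Y`. -/
def alphaHat (Y : C4 → C4) (z : C4) : C4 →L[ℝ] ℝ := (R z)⁻¹ • flat (Y z)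

/-- The nearly-Kähler 2-form `ω = dα̂₁ + 3 α̂₂ ∧ α̂₃`. -/
def omega (z : C4) : C4 [⋀^Fin 2]→L[ℝ] ℝ :=
  extDeriv (fun y => oneForm (alphaHat Y1 y)) z +
    (3 : ℝ) • wedge (alphaHat Y2 z) (alphaHat Y3 z)

/-- The pull-back `d(R³ω/3)` to `ℂ⁴ ∖ 0` of the `G₂` 3-form of the cone. -/
def phiC4 (z : C4) : C4 [⋀^Fin 3]→L[ℝ] ℝ :=
  extDeriv (fun y => (R y ^ 3 / 3) • omega y) z

/-- The local section of `ρ : ℂ⁴ ∖ 0 → 𝒞` over `{zᵢ ≠ 0}` whose image is `{zᵢ > 0}`. -/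
def localSection (i : Fin 4) (x : Cone) : C4 := slice i (coord i x)

/-- The `G₂` 3-form `φ` of the cone: `phiC4` is invariant under `U(1)` and annihilated by `Y1`,
so it is the pull-back by `ρ` of a unique form, which is computed by pulling `phiC4` back along
any local section of `ρ`. -/
def phi (x : Cone) : TangentSpace 𝓘(ℝ, Model) x [⋀^Fin 3]→L[ℝ] ℝ :=
  (phiC4 (localSection (index x) x)).compContinuousLinearMap
    (mfderiv 𝓘(ℝ, Model) 𝓘(ℝ, C4) (localSection (index x)) x)

/-! ### Submanifolds of the cone -/

/-- `W` is an embedded submanifold of dimension `d`: near each of its points it is mapped by a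
smooth chart of the cone onto a `d`-dimensional linear slice. -/
def IsSubmanifold (d : ℕ) (W : Set Cone) : Prop :=
  ∀ x ∈ W, ∃ e ∈ IsManifold.maximalAtlas 𝓘(ℝ, Model) ∞ Cone, x ∈ e.source ∧
    ∃ L : Submodule ℝ Model, Module.finrank ℝ L = d ∧ ∀ y ∈ e.source, y ∈ W ↔ e y ∈ L

/-- The vectors at `x` tangent to `W`: the velocities of smooth curves in `W` through `x`. -/
def tangentTo (W : Set Cone) (x : Cone) : Set (TangentSpace 𝓘(ℝ, Model) x) :=
  {v | ∃ γ : ℝ → Cone, ContMDiffAt 𝓘(ℝ, ℝ) 𝓘(ℝ, Model) ∞ γ 0 ∧ (∀ᶠ r in 𝓝 0, γ r ∈ W) ∧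
    γ 0 = x ∧ (mfderiv 𝓘(ℝ, ℝ) 𝓘(ℝ, Model) γ 0 (1 : ℝ) : Model) = v}

/-- A coassociative submanifold: of dimension 4, and `φ` pulls back to zero on it. -/
def IsCoassociative (W : Set Cone) : Prop :=
  IsSubmanifold 4 W ∧
    ∀ x ∈ W, ∀ v : Fin 3 → TangentSpace 𝓘(ℝ, Model) x, (∀ m, v m ∈ tangentTo W x) → phi x v = 0

/-- The unit sphere `S²` in `ℝ³`. -/
abbrev S2 : Type := Metric.sphere (0 : EuclideanSpace ℝ (Fin 3)) 1

/-- `W`, with its structure of submanifold, is diffeomorphic to the total space of the tangent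
bundle of `S²`: it is the image of a smooth embedding of that space. -/
def IsDiffeomorphicToTS2 (W : Set Cone) : Prop :=
  ∃ g : TangentBundle (𝓡 2) S2 → Cone,
    Manifold.IsSmoothEmbedding (𝓡 2).tangent 𝓘(ℝ, Model) ∞ g ∧ Set.range g = W

/-! ### The invariant functions -/

lemma conj_mul_circle (c : Circle) (x y : ℂ) :
    (c : ℂ) * x * starRingEnd ℂ ((c : ℂ) * y) = x * starRingEnd ℂ y := by
  have hc : starRingEnd ℂ (c : ℂ) * c = 1 := by
    rw [← Complex.normSq_eq_conj_mul_self]; simp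
  rw [map_mul]
  linear_combination (x * starRingEnd ℂ y) * hc

/-- The function `f₊ = z₀ z̄₃ - z̄₁ z₂`. -/
def fPlus : Cone → ℂ :=
  descend (fun z => z 0 * starRingEnd ℂ (z 3) - starRingEnd ℂ (z 1) * z 2) (by
    intro c z
    simp only [Pi.smul_apply, smul_eq_mul]
    rw [conj_mul_circle, mul_comm (starRingEnd ℂ _), conj_mul_circle, mul_comm (z 2)])

/-- The vector `𝐮 = (|z₀|² - |z₂|², 2 Re(z₀ z̄₂), -2 Im(z₀ z̄₂))`. -/
def uVec : Cone → EuclideanSpace ℝ (Fin 3) :=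
  descend (fun z => !₂[‖z 0‖ ^ 2 - ‖z 2‖ ^ 2, 2 * (z 0 * starRingEnd ℂ (z 2)).re,
    -2 * (z 0 * starRingEnd ℂ (z 2)).im]) (by
    intro c z
    simp only [Pi.smul_apply, smul_eq_mul, conj_mul_circle, norm_mul, Circle.norm_coe, one_mul])

/-- The vector `𝐯 = (|z₁|² - |z₃|², 2 Re(z₁ z̄₃), 2 Im(z₁ z̄₃))`. -/
def vVec : Cone → EuclideanSpace ℝ (Fin 3) :=
  descend (fun z => !₂[‖z 1‖ ^ 2 - ‖z 3‖ ^ 2, 2 * (z 1 * starRingEnd ℂ (z 3)).re,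
    2 * (z 1 * starRingEnd ℂ (z 3)).im]) (by
    intro c z
    simp only [Pi.smul_apply, smul_eq_mul, conj_mul_circle, norm_mul, Circle.norm_coe, one_mul])

/-- `a = 2 |f₊|²`. -/
def aFun (x : Cone) : ℝ := 2 * ‖fPlus x‖ ^ 2

/-- `b = u² - v²`, where `u = |𝐮|` and `v = |𝐯|`. -/
def bFun (x : Cone) : ℝ := ‖uVec x‖ ^ 2 - ‖vVec x‖ ^ 2

/-- `t = arg f₊`, with values in `[0, 2π)`; meaningful where `f₊ ≠ 0`. -/
def tFun (x : Cone) : ℝ := toIcoMod Real.two_pi_pos 0 (Complex.arg (fPlus x))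

/-- `s = |𝐮 + 𝐯| / R`, where `R = u + v`. -/
def sFun (x : Cone) : ℝ := ‖uVec x + vVec x‖ / (‖uVec x‖ + ‖vVec x‖)

/-- The points where `a` and `b` have the given values and, if `s < 1`, so does `t`. -/
def levelSet (a b t : ℝ) : Set Cone :=
  {x | aFun x = a ∧ bFun x = b ∧ (sFun x < 1 → tFun x = t)}

end G2Cone

end

/-! Write A = (z₀, z₂) and B = (z̄₁, z̄₃) in ℂ². Then u = |A|², v = |B|², and f₊ is the determinant
of the pair (A, B). Put h = ⟨A, B⟩ (`hermC`). Since |𝐮 + 𝐯|² = R² - 4|f₊|², the condition s < 1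
means f₊ ≠ 0, so a level set is exactly a fibre of (f₊, b) : 𝒞 → ℂ × ℝ over (f₀, b₀) with |f₀|² =
a₀/2 and arg f₀ = t₀ where f₀ ≠ 0 (`levelSet_eq`).

Submanifold: (f₊, b) is a submersion on all of ℂ⁴ ∖ 0 (`fderiv_fbC_surjective`), and it is constant
along phase orbits, so it is a submersion on 𝒞. Its fibres have dimension 7 - 3 = 4.

Coassociativity: φ pulls back to an explicit polynomial form (`phiC4_apply`). In the orthogonal
frame given by A and its quaternionic rotation, df₊ = 0 and db = 0 become linear equations on
coordinates. Substituting them reduces φ to a triple product of dependent linear functionals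
(`frame_threeForm_eq_zero`). The frame requires u > 0; an involution exchanging A and B̄-type
coordinates, and reversing φ, handles u = 0.

Topology: where u > 0, the unit vector x = 𝐮/u and the vector ξ = u⁻¹ Re(h n(A)), with n(A) ∈ ℂ³ the
null vector quadratic in A, are invariant under phases and give a point of TS². Here |ξ| = |h|, so
Lagrange's identity reads uv = |f₊|² + |ξ|². Together with u² - v² = b this determines u and v; x
then gives A up to phase, ξ gives h, and (f₊, h) gives B. Hence (f₊, b, x, ξ) separates points
(`proj_eq_of_sphereMapC_eq`), and `liftC` inverts the construction. If f₀ ≠ 0 or b₀ > 0, then u > 0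
on the whole level set, which is therefore the image of a smooth section over TS²
(`exists_section`). If f₀ = 0 and b₀ < 0, the involution changes the sign of b and reduces to that
case. -/

/-! ### Adapted charts -/

section AdaptedCharts

variable {E : Type*} [NormedAddCommGroup E] [NormedSpace ℝ E] [CompleteSpace E]
  {N : Type*} [TopologicalSpace N] [ChartedSpace E N]

/-- The inverse function theorem, as the existence of an element of the smooth groupoid. -/
theorem exists_mem_contDiffGroupoid_eqOn {Φ : E → E} {p : E} {U : Set E} (hU : IsOpen U)
    (hp : p ∈ U) (hΦ : ContDiffOn ℝ ∞ Φ U) (f' : E ≃L[ℝ] E)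
    (hf' : HasFDerivAt Φ (f' : E →L[ℝ] E) p) :
    ∃ ψ ∈ contDiffGroupoid ∞ 𝓘(ℝ, E), p ∈ ψ.source ∧ ψ.source ⊆ U ∧ ∀ y, ψ y = Φ y := by
  have hat : ∀ q ∈ U, ContDiffAt ℝ ∞ Φ q := fun q hq => hΦ.contDiffAt (hU.mem_nhds hq)
  have hcont : ContinuousOn (fderiv ℝ Φ) U := hΦ.continuousOn_fderiv_of_isOpen hU (by simp)
  -- Invertibility of the derivative is an open condition. Restricting to it makes the local inverse
  -- smooth on its whole domain, not only at the image of `p`.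
  set V : Set E := U ∩ fderiv ℝ Φ ⁻¹' Set.range ((↑) : (E ≃L[ℝ] E) → E →L[ℝ] E) with hV
  have hVo : IsOpen V := hcont.isOpen_inter_preimage hU ContinuousLinearEquiv.isOpen
  set ψ₀ := (hat p hp).toOpenPartialHomeomorph Φ hf' (by simp)
  have hpψ₀ : p ∈ ψ₀.source := (hat p hp).mem_toOpenPartialHomeomorph_source hf' (by simp)
  have hcoe : ∀ y, ψ₀ y = Φ y := fun _ => rfl
  set ψ := ψ₀.restrOpen V hVo
  have hsrc : ψ.source = ψ₀.source ∩ V := ψ₀.restrOpen_source V hVo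
  have hψ : ∀ y, ψ y = Φ y := hcoe
  refine ⟨ψ, ?_, ?_, ?_, hψ⟩
  · rw [contDiffGroupoid, mem_groupoid_of_pregroupoid]
    simp only [contDiffPregroupoid, modelWithCornersSelf_coe, modelWithCornersSelf_coe_symm,
      Function.id_comp, Function.comp_id, Set.range_id, Set.preimage_id, Set.inter_univ]
    constructor
    · refine (hΦ.mono ?_).congr fun y _ => hψ y
      rw [hsrc]; exact fun y hy => hy.2.1
    · intro y hy
      have hmem : ψ.symm y ∈ ψ.source := ψ.map_target hy
      rw [hsrc] at hmem
      obtain ⟨g, hg⟩ := hmem.2.2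
      refine (ψ.contDiffAt_symm (f₀' := g) hy ?_ ?_).contDiffWithinAt
      · rw [hg]
        exact ((hat _ hmem.2.1).differentiableAt (by simp)).hasFDerivAt
      · exact hat _ hmem.2.1
  · rw [hsrc]
    exact ⟨hpψ₀, hp, f', hf'.fderiv.symm⟩
  · rw [hsrc]; exact fun y hy => hy.2.1

/-- A chart of a manifold may be changed near a point by a map with invertible derivative. -/
theorem exists_mem_maximalAtlas_eqOn [IsManifold 𝓘(ℝ, E) ∞ N] {e : OpenPartialHomeomorph N E}
    (he : e ∈ IsManifold.maximalAtlas 𝓘(ℝ, E) ∞ N) {x : N} (hx : x ∈ e.source)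
    {Φ : E → E} {U : Set E} (hU : IsOpen U)
    (hp : e x ∈ U) (hΦ : ContDiffOn ℝ ∞ Φ U) (f' : E ≃L[ℝ] E)
    (hf' : HasFDerivAt Φ (f' : E →L[ℝ] E) (e x)) :
    ∃ e' ∈ IsManifold.maximalAtlas 𝓘(ℝ, E) ∞ N, x ∈ e'.source ∧ e'.source ⊆ e.source ∧
      (∀ y ∈ e'.source, e y ∈ U) ∧ ∀ y, e' y = Φ (e y) := by
  obtain ⟨ψ, hψ, hpψ, hψU, hψΦ⟩ := exists_mem_contDiffGroupoid_eqOn hU hp hΦ f' hf'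
  refine ⟨e.trans ψ, ?_, ?_, ?_, ?_, fun y => hψΦ _⟩
  · rw [IsManifold.mem_maximalAtlas_iff] at he ⊢
    rw [mem_maximalAtlas_iff] at he ⊢
    intro e₁ he₁
    obtain ⟨h1, h2⟩ := he e₁ he₁
    constructor
    · rw [OpenPartialHomeomorph.trans_symm_eq_symm_trans_symm, OpenPartialHomeomorph.trans_assoc]
      exact (contDiffGroupoid ∞ 𝓘(ℝ, E)).trans ((contDiffGroupoid ∞ 𝓘(ℝ, E)).symm hψ) h1
    · rw [← OpenPartialHomeomorph.trans_assoc]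
      exact (contDiffGroupoid ∞ 𝓘(ℝ, E)).trans h2 hψ
  · rw [OpenPartialHomeomorph.trans_source]; exact ⟨hx, hpψ⟩
  · rw [OpenPartialHomeomorph.trans_source]; exact Set.inter_subset_left
  · intro y hy
    rw [OpenPartialHomeomorph.trans_source] at hy
    exact hψU hy.2

end AdaptedCharts

/-! ### Level sets of submersions as linear slices -/

section Submersions

variable {E : Type*} [NormedAddCommGroup E] [NormedSpace ℝ E] [FiniteDimensional ℝ E]
  {G : Type*} [NormedAddCommGroup G] [NormedSpace ℝ G] [FiniteDimensional ℝ G]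
  {N : Type*} [TopologicalSpace N] [ChartedSpace E N] [IsManifold 𝓘(ℝ, E) ∞ N]

/-- Near a point where it is a submersion, a map `F` is linear in a suitable chart, so that its
level set through that point is a linear slice. -/
theorem exists_slice_chart_of_surjective {e : OpenPartialHomeomorph N E}
    (he : e ∈ IsManifold.maximalAtlas 𝓘(ℝ, E) ∞ N) {x : N} (hx : x ∈ e.source)
    {F : E → G} {U : Set E} (hU : IsOpen U) (hp : e x ∈ U) (hF : ContDiffOn ℝ ∞ F U)
    (hsurj : Function.Surjective (fderiv ℝ F (e x))) :
    ∃ e' ∈ IsManifold.maximalAtlas 𝓘(ℝ, E) ∞ N, x ∈ e'.source ∧ e'.source ⊆ e.source ∧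
      (∀ y ∈ e'.source, e y ∈ U) ∧
      ∃ L : Submodule ℝ E, Module.finrank ℝ L + Module.finrank ℝ G = Module.finrank ℝ E ∧
        ∀ y ∈ e'.source, F (e y) = F (e x) ↔ e' y ∈ L := by
  set D := fderiv ℝ F (e x) with hD
  set K := LinearMap.ker (D : E →ₗ[ℝ] G) with hK
  have hdim : Module.finrank ℝ K + Module.finrank ℝ G = Module.finrank ℝ E := by
    have := LinearMap.finrank_range_add_finrank_ker (D : E →ₗ[ℝ] G)
    rw [LinearMap.range_eq_top.2 hsurj, finrank_top] at this
    change _ + Module.finrank ℝ K = _ at this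
    omega
  obtain ⟨q, hq⟩ := K.subtype.exists_leftInverse_of_injective K.ker_subtype
  have hq' : ∀ k : K, q k = k := fun k => LinearMap.congr_fun hq k
  set S : E →L[ℝ] G × K := D.prod q.toContinuousLinearMap with hS
  have hinj : Function.Injective S := by
    rw [injective_iff_map_eq_zero]
    intro v hv
    have h1 : D v = 0 := congrArg Prod.fst hv
    have h2 : q v = 0 := congrArg Prod.snd hv
    have := hq' ⟨v, h1⟩
    rw [h2] at this
    exact (congrArg Subtype.val this).symm
  have hfr : Module.finrank ℝ E = Module.finrank ℝ (G × K) := by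
    rw [Module.finrank_prod]; omega
  set T : E ≃L[ℝ] G × K :=
    (LinearEquiv.ofInjectiveOfFinrankEq (S : E →ₗ[ℝ] G × K) hinj hfr).toContinuousLinearEquiv
  have hT : ∀ v, T v = (D v, q v) := fun v => rfl
  -- Since `T = (D, q)`, the derivative of `Φ` at `e x` is the identity, and the level set becomes
  -- the vanishing of the first component of `T ∘ Φ`.
  set Φ : E → E := fun y => T.symm (F y - F (e x), q y) with hΦ
  have hΦc : ContDiffOn ℝ ∞ Φ U := by
    refine T.symm.contDiff.comp_contDiffOn ?_
    exact (hF.sub contDiffOn_const).prodMk q.toContinuousLinearMap.contDiff.contDiffOn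
  have hΦd : HasFDerivAt Φ ((ContinuousLinearEquiv.refl ℝ E : E ≃L[ℝ] E) : E →L[ℝ] E) (e x) := by
    have h1 : HasFDerivAt (fun y => F y - F (e x)) D (e x) :=
      ((hF.contDiffAt (hU.mem_nhds hp)).differentiableAt (by simp)).hasFDerivAt.sub_const _
    have h2 : HasFDerivAt (fun y => q y) q.toContinuousLinearMap (e x) :=
      q.toContinuousLinearMap.hasFDerivAt
    have h3 := (T.symm : (G × K) →L[ℝ] E).hasFDerivAt.comp (e x) (h1.prodMk h2)
    refine h3.congr_fderiv ?_
    ext v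
    change T.symm (D v, q v) = v
    rw [← hT, T.symm_apply_apply]
  obtain ⟨e', he', hx', hsub, hU', hval⟩ := exists_mem_maximalAtlas_eqOn he hx hU hp hΦc _ hΦd
  refine ⟨e', he', hx', hsub, hU', Submodule.map (T.symm : (G × K) →ₗ[ℝ] E)
    (LinearMap.range (LinearMap.inr ℝ G K)), ?_, fun y hy => ?_⟩
  · rw [← hdim]
    congr 1
    have h1 := LinearEquiv.finrank_map_eq T.symm.toLinearEquiv
      (LinearMap.range (LinearMap.inr ℝ G K))
    have h2 := LinearMap.finrank_range_of_inj (f := LinearMap.inr ℝ G K) LinearMap.inr_injective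
    exact h1.trans h2
  · rw [hval y]
    simp only [hΦ, Submodule.mem_map, LinearMap.mem_range]
    constructor
    · intro h
      exact ⟨_, ⟨q (e y), rfl⟩, by rw [h, sub_self]; rfl⟩
    · rintro ⟨_, ⟨k, rfl⟩, hk⟩
      have := T.symm.injective hk
      exact (sub_eq_zero.1 (congrArg Prod.fst this).symm)

end Submersions

/-! ### Immersions from smooth local left inverses -/

section Immersions

variable {E : Type*} [NormedAddCommGroup E] [NormedSpace ℝ E] [FiniteDimensional ℝ E]
  {H : Type*} [TopologicalSpace H] {I : ModelWithCorners ℝ E H}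
  {M : Type*} [TopologicalSpace M] [ChartedSpace H M] [IsManifold I ∞ M]
  {E' : Type*} [NormedAddCommGroup E'] [NormedSpace ℝ E'] [FiniteDimensional ℝ E']
  {N : Type*} [TopologicalSpace N] [ChartedSpace E' N] [IsManifold 𝓘(ℝ, E') ∞ N]
  {F : Type*} [NormedAddCommGroup F] [NormedSpace ℝ F] [FiniteDimensional ℝ F]

/-- A smooth map that has a smooth left inverse near a point is an immersion at that point. -/
theorem isImmersionAtOfComplement_of_leftInverse [I.Boundaryless]
    (hF : Module.finrank ℝ E + Module.finrank ℝ F = Module.finrank ℝ E')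
    {f : M → N} {x : M} (hf : ContMDiff I 𝓘(ℝ, E') ∞ f)
    {k : N → E} {V : Set N} (hV : IsOpen V) (hxV : f x ∈ V)
    (hk : ContMDiffOn 𝓘(ℝ, E') 𝓘(ℝ, E) ∞ k V)
    (hkf : ∀ᶠ y in 𝓝 x, k (f y) = extChartAt I x y) :
    Manifold.IsImmersionAtOfComplement F I 𝓘(ℝ, E') ∞ f x := by
  classical
  set e := chartAt E' (f x)
  have he : e ∈ IsManifold.maximalAtlas 𝓘(ℝ, E') ∞ N := IsManifold.chart_mem_maximalAtlas _
  have hfe : f x ∈ e.source := mem_chart_source _ _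
  set a := e (f x) with ha
  -- the left inverse in the charts
  set k' : E' → E := k ∘ e.symm with hk'
  have hk'U : IsOpen (e.target ∩ e.symm ⁻¹' V) := e.isOpen_inter_preimage_symm hV
  have hk's : ContDiffOn ℝ ∞ k' (e.target ∩ e.symm ⁻¹' V) := by
    rw [← contMDiffOn_iff_contDiffOn]
    exact hk.comp ((contMDiffOn_symm_of_mem_maximalAtlas he).mono Set.inter_subset_left)
      (fun y hy => hy.2)
  -- the map in the charts
  set φ := extChartAt I x
  set h : E → E' := e ∘ f ∘ φ.symm with hh
  set W : Set E := φ.target ∩ φ.symm ⁻¹' (f ⁻¹' e.source) with hW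
  have hWo : IsOpen W :=
    (continuousOn_extChartAt_symm (I := I) x).isOpen_inter_preimage
      (isOpen_extChartAt_target (I := I) x)
      (e.open_source.preimage hf.continuous)
  have hhs : ContDiffOn ℝ ∞ h W := by
    rw [← contMDiffOn_iff_contDiffOn]
    refine (contMDiffOn_of_mem_maximalAtlas he).comp (hf.comp_contMDiffOn
      ((contMDiffOn_extChartAt_symm (I := I) x).mono Set.inter_subset_left)) (fun y hy => hy.2)
  set u₀ := φ x with hu₀
  have hu₀W : u₀ ∈ W := by
    refine ⟨mem_extChartAt_target x, ?_⟩
    change f (φ.symm (φ x)) ∈ e.source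
    rw [extChartAt_to_inv]; exact hfe
  have hha : h u₀ = a := by
    change e (f (φ.symm (φ x))) = a
    rw [extChartAt_to_inv]
  have haU : a ∈ e.target ∩ e.symm ⁻¹' V := by
    refine ⟨e.map_source hfe, ?_⟩
    change e.symm (e (f x)) ∈ V
    rwa [e.left_inv hfe]
  have hka : k' a = u₀ := by
    change k (e.symm (e (f x))) = φ x
    rw [e.left_inv hfe]; exact hkf.self_of_nhds
  have hcomp : ∀ᶠ u in 𝓝 u₀, k' (h u) = u := by
    have h1 : ∀ᶠ u in 𝓝 u₀, k (f (φ.symm u)) = φ (φ.symm u) :=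
      (continuousAt_extChartAt_symm (I := I) x).eventually (by rw [extChartAt_to_inv]; exact hkf)
    filter_upwards [h1, hWo.mem_nhds hu₀W] with u hu huW
    change k (e.symm (e (f (φ.symm u)))) = u
    rw [e.left_inv huW.2, hu, φ.right_inv huW.1]
  set D := fderiv ℝ k' a
  set Dh := fderiv ℝ h u₀
  have hDk : HasFDerivAt k' D a :=
    ((hk's.contDiffAt (hk'U.mem_nhds haU)).differentiableAt (by simp)).hasFDerivAt
  have hDh : HasFDerivAt h Dh u₀ :=
    ((hhs.contDiffAt (hWo.mem_nhds hu₀W)).differentiableAt (by simp)).hasFDerivAt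
  have hDD : ∀ v, D (Dh v) = v := by
    have h1 : HasFDerivAt (k' ∘ h) (D.comp Dh) u₀ := by
      refine HasFDerivAt.comp u₀ ?_ hDh
      rwa [hha]
    have h2 : HasFDerivAt (k' ∘ h) (ContinuousLinearMap.id ℝ E) u₀ :=
      (hasFDerivAt_id u₀).congr_of_eventuallyEq hcomp
    intro v
    exact DFunLike.congr_fun (h1.unique h2) v
  set K := LinearMap.ker (D : E' →ₗ[ℝ] E) with hK
  have hdim : Module.finrank ℝ K = Module.finrank ℝ F := by
    have := LinearMap.finrank_range_add_finrank_ker (D : E' →ₗ[ℝ] E)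
    rw [LinearMap.range_eq_top.2 (fun v => ⟨Dh v, hDD v⟩), finrank_top] at this
    change _ + Module.finrank ℝ K = _ at this
    omega
  obtain ⟨κ⟩ := FiniteDimensional.nonempty_continuousLinearEquiv_of_finrank_eq hdim
  obtain ⟨q, hq⟩ := K.subtype.exists_leftInverse_of_injective K.ker_subtype
  have hq' : ∀ k : K, q k = k := fun k => LinearMap.congr_fun hq k
  set Q : E' →L[ℝ] F := (κ : K →L[ℝ] F).comp q.toContinuousLinearMap with hQ
  obtain ⟨T⟩ := FiniteDimensional.nonempty_continuousLinearEquiv_of_finrank_eq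
    (𝕜 := ℝ) (E := E × F) (F := E') (by rw [Module.finrank_prod, hF])
  -- The first component is the left inverse, so on the image `y = h u` it equals `u` and the second
  -- vanishes: `Φ ∘ h` is the linear inclusion. The derivative is invertible because `Q` is
  -- injective on `ker D`.
  set Φ : E' → E' := fun y => T (k' y, Q (y - h (k' y))) with hΦ
  set U : Set E' := (e.target ∩ e.symm ⁻¹' V) ∩ k' ⁻¹' W with hU
  have hUo : IsOpen U := hk's.continuousOn.isOpen_inter_preimage hk'U hWo
  have haU' : a ∈ U := ⟨haU, by change k' a ∈ W; rwa [hka]⟩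
  have hΦs : ContDiffOn ℝ ∞ Φ U := by
    have h1 : ContDiffOn ℝ ∞ k' U := hk's.mono Set.inter_subset_left
    refine T.contDiff.comp_contDiffOn (h1.prodMk (Q.contDiff.comp_contDiffOn ?_))
    exact contDiffOn_id.sub (hhs.comp h1 fun y hy => hy.2)
  set S : E' →L[ℝ] E × F := D.prod (Q.comp (ContinuousLinearMap.id ℝ E' - Dh.comp D)) with hS
  have hinj : Function.Injective S := by
    rw [injective_iff_map_eq_zero]
    intro v hv
    have h1 : D v = 0 := congrArg Prod.fst hv
    have h2 : κ (q (v - Dh (D v))) = 0 := congrArg Prod.snd hv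
    rw [h1, map_zero, sub_zero] at h2
    have h3 := κ.map_eq_zero_iff.1 h2
    have := hq' ⟨v, h1⟩
    rw [h3] at this
    exact (congrArg Subtype.val this).symm
  set S' : E' ≃L[ℝ] E × F := (LinearEquiv.ofInjectiveOfFinrankEq (S : E' →ₗ[ℝ] E × F) hinj
    (by rw [Module.finrank_prod, hF])).toContinuousLinearEquiv
  have hΦd : HasFDerivAt Φ ((S'.trans T : E' ≃L[ℝ] E') : E' →L[ℝ] E') a := by
    have h1 : HasFDerivAt (fun y => h (k' y)) (Dh.comp D) a := by
      refine HasFDerivAt.comp (g := h) a ?_ hDk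
      rwa [hka]
    exact (T : (E × F) →L[ℝ] E').hasFDerivAt.comp a
      (hDk.prodMk (Q.hasFDerivAt.comp a ((hasFDerivAt_id a).sub h1)))
  obtain ⟨e', he', hx', hsub, -, hval⟩ := exists_mem_maximalAtlas_eqOn he hfe hUo haU' hΦs _ hΦd
  -- shrink the chart of the source
  obtain ⟨s, hs, hso, hxs⟩ := eventually_nhds_iff.1
    ((continuousAt_extChartAt (I := I) x).eventually hcomp)
  set c := (chartAt H x).restr (s ∩ f ⁻¹' e'.source) with hc
  have hso' : IsOpen (s ∩ f ⁻¹' e'.source) := hso.inter (e'.open_source.preimage hf.continuous)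
  have hcs : c.source = (chartAt H x).source ∩ (s ∩ f ⁻¹' e'.source) :=
    (chartAt H x).restr_source' _ hso'
  refine Manifold.IsImmersionAtOfComplement.mk_of_charts T c e' ?_ hx' ?_ he' ?_ ?_
  · rw [hcs]; exact ⟨mem_chart_source H x, hxs, hx'⟩
  · exact restr_mem_maximalAtlas (contDiffGroupoid ∞ I) (IsManifold.chart_mem_maximalAtlas x) hso'
  · rw [hcs]; exact fun y hy => hy.2.2
  · intro u hu
    have hy : (c.extend I).symm u ∈ c.source := by
      rw [← c.extend_source (I := I)]; exact (c.extend I).map_target hu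
    have huy : φ ((c.extend I).symm u) = u := (c.extend I).right_inv hu
    set y := (c.extend I).symm u
    rw [hcs] at hy
    have hys : y ∈ φ.source := by rw [extChartAt_source]; exact hy.1
    have hyu : φ.symm u = y := by rw [← huy]; exact φ.left_inv hys
    have h1 : h u = e (f y) := by change e (f (φ.symm u)) = _; rw [hyu]
    have h2 : k' (h u) = u := by have := hs y hy.2.1; rwa [huy] at this
    change e' (f y) = T (u, 0)
    rw [hval, ← h1]
    simp only [hΦ, h2, sub_self, map_zero]

end Immersions

noncomputable section

namespace G2Cone

/-! ### Smooth maps to and from the cone -/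

lemma chart_mem_maximalAtlas (i : Fin 4) :
    chart i ∈ IsManifold.maximalAtlas 𝓘(ℝ, Model) ∞ Cone :=
  IsManifold.subset_maximalAtlas ⟨i, rfl⟩

lemma proj_eq_chart_symm (i : Fin 4) {z : C4} (hz : z i ≠ 0) :
    proj z = (chart i).symm (normalise i z) := by
  have hz' : z ≠ 0 := fun h => hz (congrFun h i)
  rw [proj_of_ne hz']
  exact (proj_slice_coord i _ ((mem_patch_toCone i ⟨z, hz'⟩).2 hz)).symm

lemma contMDiffAt_proj {z : C4} (hz : z ≠ 0) :
    ContMDiffAt 𝓘(ℝ, C4) 𝓘(ℝ, Model) ∞ proj z := by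
  obtain ⟨i, hi⟩ := Function.ne_iff.1 hz
  have hi' : z i ≠ 0 := hi
  have hmem : normalise i z ∈ (chart i).target := by
    change 0 < ‖z i‖
    exact norm_pos_iff.2 hi'
  have h1 : ContMDiffAt 𝓘(ℝ, Model) 𝓘(ℝ, Model) ∞ (chart i).symm (normalise i z) :=
    contMDiffAt_symm_of_mem_maximalAtlas (chart_mem_maximalAtlas i) hmem
  refine (h1.comp z (contDiffAt_normalise i z hi').contMDiffAt).congr_of_eventuallyEq ?_
  have : {y : C4 | y i ≠ 0} ∈ 𝓝 z :=
    (isOpen_ne_fun (continuous_apply i) continuous_const).mem_nhds hi'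
  filter_upwards [this] with y hy
  exact proj_eq_chart_symm i hy

lemma contMDiffAt_localSection (i : Fin 4) {x : Cone} (hx : x ∈ patch i) :
    ContMDiffAt 𝓘(ℝ, Model) 𝓘(ℝ, C4) ∞ (localSection i) x :=
  (slice i).contMDiff.contMDiffAt.comp x
    (contMDiffAt_of_mem_maximalAtlas (chart_mem_maximalAtlas i) hx)

lemma localSection_ne_zero (i : Fin 4) {x : Cone} (hx : x ∈ patch i) : localSection i x ≠ 0 :=
  slice_ne_zero i _ hx

lemma proj_localSection (i : Fin 4) {x : Cone} (hx : x ∈ patch i) :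
    proj (localSection i x) = x :=
  proj_slice_coord i x hx

lemma descend_proj {X : Type} (F : C4 → X) (hF) {z : C4} (hz : z ≠ 0) :
    descend F hF (proj z) = F z := by
  rw [proj_of_ne hz]; rfl

lemma descend_eq_localSection {X : Type} (F : C4 → X) (hF) (i : Fin 4) {x : Cone}
    (hx : x ∈ patch i) : descend F hF x = F (localSection i x) := by
  conv_lhs => rw [← proj_localSection i hx]
  exact descend_proj F hF (localSection_ne_zero i hx)

lemma exists_proj_eq (x : Cone) : ∃ z, z ≠ 0 ∧ proj z = x :=
  ⟨_, localSection_ne_zero _ (mem_patch_index x), proj_localSection _ (mem_patch_index x)⟩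

lemma proj_smul (c : Circle) (z : C4) (hz : z ≠ 0) : proj ((c : ℂ) • z) = proj z := by
  have hc : (c : ℂ) • z ≠ 0 := smul_ne_zero c.coe_ne_zero hz
  rw [proj_of_ne hz, proj_of_ne hc]
  exact (Quotient.sound (s := phaseSetoid) ⟨c, rfl⟩ : toCone _ = toCone _).symm

/-- Near the point the induced map is `F` composed with a local section. The value of that section
differs from `z` by a phase, and invariance of `F` carries smoothness from `z` to it. -/
lemma contMDiffAt_descend {X : Type} {E H : Type*} [NormedAddCommGroup E] [NormedSpace ℝ E]
    [TopologicalSpace H] {I : ModelWithCorners ℝ E H} [TopologicalSpace X] [ChartedSpace H X]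
    {F : C4 → X} (hF) {z : C4} (hz : z ≠ 0)
    (h : ContMDiffAt 𝓘(ℝ, C4) I ∞ F z) :
    ContMDiffAt 𝓘(ℝ, Model) I ∞ (descend F hF) (proj z) := by
  obtain ⟨i, hi⟩ := Function.ne_iff.1 hz
  have hi' : z i ≠ 0 := hi
  have hx : proj z ∈ patch i := by rw [proj_of_ne hz]; exact (mem_patch_toCone i _).2 hi'
  have hls : localSection i (proj z) = (starRingEnd ℂ (z i) / (‖z i‖ : ℂ)) • z := by
    rw [← slice_normalise i z hi', proj_of_ne hz]; rfl
  have h0 : ‖z i‖ ≠ 0 := by simpa using hi'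
  let c : Circle := ⟨starRingEnd ℂ (z i) / (‖z i‖ : ℂ), by simp [Submonoid.unitSphere, h0]⟩
  have hc : localSection i (proj z) = (c : ℂ) • z := hls
  have h2 : ContMDiffAt 𝓘(ℝ, C4) I ∞ F (localSection i (proj z)) := by
    rw [hc]
    have h3 : ContMDiffAt 𝓘(ℝ, C4) 𝓘(ℝ, C4) ∞ (fun y => ((c⁻¹ : Circle) : ℂ) • y)
        ((c : ℂ) • z) := by
      refine ContDiffAt.contMDiffAt ?_
      fun_prop
    have h4 : ContMDiffAt 𝓘(ℝ, C4) I ∞ F (((c⁻¹ : Circle) : ℂ) • (c : ℂ) • z) := by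
      rw [smul_smul, ← Circle.coe_mul, inv_mul_cancel, Circle.coe_one, one_smul]; exact h
    refine (h4.comp ((c : ℂ) • z) h3).congr_of_eventuallyEq ?_
    exact Filter.Eventually.of_forall fun y => (hF c⁻¹ y).symm
  refine (h2.comp (proj z) (contMDiffAt_localSection i hx)).congr_of_eventuallyEq ?_
  filter_upwards [(isOpen_patch i).mem_nhds hx] with y hy
  exact descend_eq_localSection F hF i hy

/-! ### The invariant functions on `ℂ⁴` and their derivatives -/

/-- The pull-back of `f₊` to `ℂ⁴`. -/
def fC (z : C4) : ℂ := z 0 * starRingEnd ℂ (z 3) - starRingEnd ℂ (z 1) * z 2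

/-- The pull-back of `u` to `ℂ⁴`. -/
def uC (z : C4) : ℝ := ‖z 0‖ ^ 2 + ‖z 2‖ ^ 2

/-- The pull-back of `v` to `ℂ⁴`. -/
def vC (z : C4) : ℝ := ‖z 1‖ ^ 2 + ‖z 3‖ ^ 2

/-- The pull-back of `b` to `ℂ⁴`. -/
def bC (z : C4) : ℝ := uC z ^ 2 - vC z ^ 2

lemma fPlus_proj {z : C4} (hz : z ≠ 0) : fPlus (proj z) = fC z := descend_proj _ _ hz

lemma norm_uVec_proj {z : C4} (hz : z ≠ 0) : ‖uVec (proj z)‖ = uC z := by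
  rw [uVec, descend_proj _ _ hz, EuclideanSpace.norm_eq, Real.sqrt_eq_iff_eq_sq (by positivity)
    (by unfold uC; positivity)]
  simp [Fin.sum_univ_three, uC, Complex.sq_norm, Complex.normSq_apply]
  ring

lemma norm_vVec_proj {z : C4} (hz : z ≠ 0) : ‖vVec (proj z)‖ = vC z := by
  rw [vVec, descend_proj _ _ hz, EuclideanSpace.norm_eq, Real.sqrt_eq_iff_eq_sq (by positivity)
    (by unfold vC; positivity)]
  simp [Fin.sum_univ_three, vC, Complex.sq_norm, Complex.normSq_apply]
  ring

/-- This identity gives s² = 1 - 4|f₊|²/R², which is why s = 1 exactly on the zeros of f₊. -/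
lemma norm_uVec_add_vVec_proj {z : C4} (hz : z ≠ 0) :
    ‖uVec (proj z) + vVec (proj z)‖ ^ 2 = (uC z + vC z) ^ 2 - 4 * ‖fC z‖ ^ 2 := by
  rw [uVec, vVec, descend_proj _ _ hz, descend_proj _ _ hz, EuclideanSpace.norm_sq_eq]
  simp [Fin.sum_univ_three, uC, vC, fC, Complex.sq_norm, Complex.normSq_apply]
  ring

lemma bFun_proj {z : C4} (hz : z ≠ 0) : bFun (proj z) = bC z := by
  rw [bFun, norm_uVec_proj hz, norm_vVec_proj hz, bC]

lemma uC_nonneg (z : C4) : 0 ≤ uC z := by unfold uC; positivity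

lemma vC_nonneg (z : C4) : 0 ≤ vC z := by unfold vC; positivity

lemma uC_pos_iff {z : C4} : 0 < uC z ↔ z 0 ≠ 0 ∨ z 2 ≠ 0 := by
  constructor
  · intro h
    by_contra! h0
    simp [uC, h0.1, h0.2] at h
  · unfold uC
    rintro (h | h)
    · have := norm_pos_iff.2 h; positivity
    · have := norm_pos_iff.2 h; positivity

lemma vC_pos_iff {z : C4} : 0 < vC z ↔ z 1 ≠ 0 ∨ z 3 ≠ 0 := by
  constructor
  · intro h
    by_contra! h0
    simp [vC, h0.1, h0.2] at h
  · unfold vC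
    rintro (h | h)
    · have := norm_pos_iff.2 h; positivity
    · have := norm_pos_iff.2 h; positivity

lemma uC_add_vC_pos {z : C4} (hz : z ≠ 0) : 0 < uC z + vC z := by
  obtain ⟨i, hi⟩ := Function.ne_iff.1 hz
  have hi' : z i ≠ 0 := hi
  have h1 := uC_nonneg z
  have h2 := vC_nonneg z
  fin_cases i
  · have := uC_pos_iff.2 (Or.inl hi'); linarith
  · have := vC_pos_iff.2 (Or.inl hi'); linarith
  · have := uC_pos_iff.2 (Or.inr hi'); linarith
  · have := vC_pos_iff.2 (Or.inr hi'); linarith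

lemma sFun_proj_lt_one_iff {z : C4} (hz : z ≠ 0) : sFun (proj z) < 1 ↔ fC z ≠ 0 := by
  have hR := uC_add_vC_pos hz
  rw [sFun, norm_uVec_proj hz, norm_vVec_proj hz, div_lt_one hR,
    ← sq_lt_sq₀ (norm_nonneg _) hR.le, norm_uVec_add_vVec_proj hz, ← norm_pos_iff]
  constructor
  · intro h
    by_contra! h0
    have : ‖fC z‖ = 0 := le_antisymm h0 (norm_nonneg _)
    rw [this] at h
    linarith
  · intro h
    have : 0 < ‖fC z‖ ^ 2 := by positivity
    linarith

lemma toIcoMod_arg_eq_iff {f : ℂ} (hf : f ≠ 0) {t : ℝ} (ht : t ∈ Set.Ico 0 (2 * Real.pi)) :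
    toIcoMod Real.two_pi_pos 0 f.arg = t ↔ f = ‖f‖ * Complex.exp (t * Complex.I) := by
  have hn : (‖f‖ : ℂ) ≠ 0 := by simpa using hf
  have key : f = ‖f‖ * Complex.exp (t * Complex.I) ↔
      Complex.exp (f.arg * Complex.I) = Complex.exp (t * Complex.I) := by
    conv_lhs => lhs; rw [← Complex.norm_mul_exp_arg_mul_I f]
    exact mul_right_inj' hn
  rw [key, Complex.exp_eq_exp_iff_exists_int, toIcoMod_eq_iff]
  constructor
  · rintro ⟨-, n, hn⟩
    refine ⟨n, ?_⟩
    rw [hn]; push_cast; simp; ring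
  · rintro ⟨n, hn⟩
    refine ⟨by simpa using ht, n, ?_⟩
    have : (f.arg : ℂ) * Complex.I = ((t + n * (2 * Real.pi) : ℝ) : ℂ) * Complex.I := by
      rw [hn]; push_cast; ring
    have := mul_right_cancel₀ Complex.I_ne_zero this
    rw [Complex.ofReal_inj] at this
    rw [this]; simp

/-- The value of `f₊` on the level set. -/
def levelValue (a t : ℝ) : ℂ := (Real.sqrt (a / 2) : ℂ) * Complex.exp (t * Complex.I)

lemma norm_levelValue (a t : ℝ) : ‖levelValue a t‖ = Real.sqrt (a / 2) := by
  simp [levelValue, Complex.norm_exp_ofReal_mul_I, abs_of_nonneg (Real.sqrt_nonneg _)]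

/-- Modulus and argument fix f₊ where it is nonzero. Where it vanishes, a = 0, so `levelValue a t`
is 0 for every `t` and the missing condition on `t` costs nothing. -/
lemma levelSet_eq {a b t : ℝ} (ha : 0 ≤ a) (ht : t ∈ Set.Ico 0 (2 * Real.pi)) :
    levelSet a b t = {x | fPlus x = levelValue a t ∧ bFun x = b} := by
  ext x
  obtain ⟨z, hz, rfl⟩ := exists_proj_eq x
  simp only [levelSet, Set.mem_ofPred_eq, sFun_proj_lt_one_iff hz, aFun, tFun, fPlus_proj hz]
  have hs : Real.sqrt (a / 2) ^ 2 = a / 2 := Real.sq_sqrt (by positivity)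
  constructor
  · rintro ⟨h1, h2, h3⟩
    refine ⟨?_, h2⟩
    have hn : ‖fC z‖ = Real.sqrt (a / 2) := by
      rw [← sq_eq_sq₀ (norm_nonneg _) (Real.sqrt_nonneg _), hs]; linarith
    by_cases hf : fC z = 0
    · rw [hf, norm_zero] at hn
      rw [hf, levelValue, ← hn]; simp
    · rw [(toIcoMod_arg_eq_iff hf ht).1 (h3 hf), hn, levelValue]
  · rintro ⟨h1, h2⟩
    have hn : ‖fC z‖ = Real.sqrt (a / 2) := by rw [h1, norm_levelValue]
    refine ⟨?_, h2, fun hf => (toIcoMod_arg_eq_iff hf ht).2 ?_⟩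
    · rw [hn, hs]; ring
    · rw [hn, h1, levelValue]

/-- The derivative of `fC`. -/
def dfC (z w : C4) : ℂ :=
  w 0 * starRingEnd ℂ (z 3) + z 0 * starRingEnd ℂ (w 3) - starRingEnd ℂ (w 1) * z 2 -
    starRingEnd ℂ (z 1) * w 2

/-- The derivative of `uC`. -/
def duC (z w : C4) : ℝ :=
  2 * ((starRingEnd ℂ (z 0) * w 0).re + (starRingEnd ℂ (z 2) * w 2).re)

/-- The derivative of `vC`. -/
def dvC (z w : C4) : ℝ :=
  2 * ((starRingEnd ℂ (z 1) * w 1).re + (starRingEnd ℂ (z 3) * w 3).re)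

lemma hasFDerivAt_coord (i : Fin 4) (z : C4) : HasFDerivAt (fun z : C4 => z i)
    (ContinuousLinearMap.proj (R := ℝ) (φ := fun _ : Fin 4 => ℂ) i) z :=
  (ContinuousLinearMap.proj (R := ℝ) (φ := fun _ : Fin 4 => ℂ) i).hasFDerivAt

lemma hasFDerivAt_conj_coord (i : Fin 4) (z : C4) :
    HasFDerivAt (fun z : C4 => starRingEnd ℂ (z i))
      ((Complex.conjCLE : ℂ →L[ℝ] ℂ).comp
        (ContinuousLinearMap.proj (R := ℝ) (φ := fun _ : Fin 4 => ℂ) i)) z :=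
  ((Complex.conjCLE : ℂ →L[ℝ] ℂ).comp
    (ContinuousLinearMap.proj (R := ℝ) (φ := fun _ : Fin 4 => ℂ) i)).hasFDerivAt

lemma contDiff_conj_coord (i : Fin 4) :
    ContDiff ℝ ∞ (fun z : C4 => starRingEnd ℂ (z i)) :=
  Complex.conjCLE.contDiff.comp (by fun_prop)

lemma contDiff_fC : ContDiff ℝ ∞ fC := by
  have h0 : ContDiff ℝ ∞ (fun z : C4 => z 0) := by fun_prop
  have h2 : ContDiff ℝ ∞ (fun z : C4 => z 2) := by fun_prop
  exact (h0.mul (contDiff_conj_coord 3)).sub ((contDiff_conj_coord 1).mul h2)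

lemma contDiff_uC : ContDiff ℝ ∞ uC := by
  have h (i : Fin 4) : ContDiff ℝ ∞ (fun z : C4 => ‖z i‖ ^ 2) :=
    ContDiff.norm_sq ℝ (by fun_prop)
  exact (h 0).add (h 2)

lemma contDiff_vC : ContDiff ℝ ∞ vC := by
  have h (i : Fin 4) : ContDiff ℝ ∞ (fun z : C4 => ‖z i‖ ^ 2) :=
    ContDiff.norm_sq ℝ (by fun_prop)
  exact (h 1).add (h 3)

lemma contDiff_bC : ContDiff ℝ ∞ bC := (contDiff_uC.pow 2).sub (contDiff_vC.pow 2)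

lemma fderiv_fC (z w : C4) : fderiv ℝ fC z w = dfC z w := by
  have h := ((hasFDerivAt_coord 0 z).mul (hasFDerivAt_conj_coord 3 z)).sub
    ((hasFDerivAt_conj_coord 1 z).mul (hasFDerivAt_coord 2 z))
  rw [HasFDerivAt.fderiv (show HasFDerivAt fC _ z from h)]
  simp [dfC]
  ring

lemma fderiv_uC (z w : C4) : fderiv ℝ uC z w = duC z w := by
  have h := (hasFDerivAt_coord 0 z).norm_sq.add (hasFDerivAt_coord 2 z).norm_sq
  rw [HasFDerivAt.fderiv (show HasFDerivAt uC _ z from h)]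
  simp [duC, Complex.inner]
  ring

lemma fderiv_vC (z w : C4) : fderiv ℝ vC z w = dvC z w := by
  have h := (hasFDerivAt_coord 1 z).norm_sq.add (hasFDerivAt_coord 3 z).norm_sq
  rw [HasFDerivAt.fderiv (show HasFDerivAt vC _ z from h)]
  simp [dvC, Complex.inner]
  ring

lemma fderiv_bC (z w : C4) :
    fderiv ℝ bC z w = 2 * uC z * duC z w - 2 * vC z * dvC z w := by
  have hu : HasFDerivAt uC (fderiv ℝ uC z) z :=
    (contDiff_uC.differentiable (by simp) z).hasFDerivAt
  have hv : HasFDerivAt vC (fderiv ℝ vC z) z :=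
    (contDiff_vC.differentiable (by simp) z).hasFDerivAt
  have h := (hu.pow 2).sub (hv.pow 2)
  rw [HasFDerivAt.fderiv (show HasFDerivAt bC _ z from h)]
  simp [fderiv_uC, fderiv_vC]

/-! ### The level sets are submanifolds -/

/-- The map `(f₊, b)` on `ℂ⁴`. -/
def fbC (z : C4) : ℂ × ℝ := (fC z, bC z)

lemma contDiff_fbC : ContDiff ℝ ∞ fbC := contDiff_fC.prodMk contDiff_bC

lemma fderiv_fbC (z w : C4) :
    fderiv ℝ fbC z w = (dfC z w, 2 * uC z * duC z w - 2 * vC z * dvC z w) := by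
  have h1 := (contDiff_fC.differentiable (by simp) z).hasFDerivAt
  have h2 := (contDiff_bC.differentiable (by simp) z).hasFDerivAt
  change fderiv ℝ (fun z => (fC z, bC z)) z w = _
  rw [HasFDerivAt.fderiv (h1.prodMk h2)]
  simp [fderiv_fC, fderiv_bC]

/-- Lagrange's identity for A = (z₀, z₂) and B = (z̄₁, z̄₃): the squared moduli of their determinant
and of their Hermitian product add up to |A|²|B|². -/
lemma norm_fC_sq_le (z : C4) : ‖fC z‖ ^ 2 ≤ uC z * vC z := by
  have : uC z * vC z = ‖fC z‖ ^ 2 +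
      ‖starRingEnd ℂ (z 0) * starRingEnd ℂ (z 1) +
        starRingEnd ℂ (z 2) * starRingEnd ℂ (z 3)‖ ^ 2 := by
    simp [uC, vC, fC, Complex.sq_norm, Complex.normSq_apply]
    ring
  rw [this]
  have := sq_nonneg ‖starRingEnd ℂ (z 0) * starRingEnd ℂ (z 1) +
    starRingEnd ℂ (z 2) * starRingEnd ℂ (z 3)‖
  linarith

/-- The vectors along which `f₊` varies. -/
def fDir (l : ℂ) (z : C4) : C4 :=
  ![l * z 3, -(starRingEnd ℂ l * z 2), -(l * z 1), starRingEnd ℂ l * z 0]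

/-- A vector along which `b` varies. -/
def bDir (z : C4) : C4 := ![uC z * z 0, -(vC z * z 1), uC z * z 2, -(vC z * z 3)]

/-- The directions `fDir l z` already cover the ℂ factor, since f₊ changes by lR. It remains to find
a direction that fixes f₊ to first order and moves b. -/
lemma fderiv_fbC_surjective {z : C4} (hz : z ≠ 0) : Function.Surjective (fderiv ℝ fbC z) := by
  set u := uC z with hu
  set v := vC z with hv
  have hu' : u = (z 0).re ^ 2 + (z 0).im ^ 2 + ((z 2).re ^ 2 + (z 2).im ^ 2) := by
    simp [hu, uC, Complex.sq_norm, Complex.normSq_apply]; ring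
  have hv' : v = (z 1).re ^ 2 + (z 1).im ^ 2 + ((z 3).re ^ 2 + (z 3).im ^ 2) := by
    simp [hv, vC, Complex.sq_norm, Complex.normSq_apply]; ring
  have hR : 0 < u + v := uC_add_vC_pos hz
  have hu0 : 0 ≤ u := uC_nonneg z
  have hv0 : 0 ≤ v := vC_nonneg z
  -- the images of the two directions
  have h1 (l : ℂ) : fderiv ℝ fbC z (fDir l z) =
      (l * (u + v : ℝ), 4 * (u - v) * (l * starRingEnd ℂ (fC z)).re) := by
    rw [fderiv_fbC, ← hu, ← hv]
    refine Prod.ext ?_ ?_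
    · apply Complex.ext
      · simp [dfC, fDir]; linear_combination (-l.re) * hu' - l.re * hv'
      · simp [dfC, fDir]; linear_combination (-l.im) * hu' - l.im * hv'
    · simp [duC, dvC, fC, fDir]; ring
  have h2 : fderiv ℝ fbC z (bDir z) = ((u - v : ℝ) * fC z, 4 * (u ^ 3 + v ^ 3)) := by
    rw [fderiv_fbC, ← hu, ← hv]
    refine Prod.ext ?_ ?_
    · apply Complex.ext <;> simp [dfC, bDir, ← hu, ← hv, fC] <;> ring
    · simp [duC, dvC, bDir, ← hu, ← hv]
      linear_combination (-4 * u ^ 2) * hu' - 4 * v ^ 2 * hv'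
  -- Positivity rests on |f₊|² ≤ uv and on (u + v)(u³ + v³) - (u - v)²uv = (u² + v²)².
  set M : ℝ := 4 * ((u + v) * (u ^ 3 + v ^ 3) - (u - v) ^ 2 * ‖fC z‖ ^ 2) with hM
  have hMpos : 0 < M := by
    have hle := norm_fC_sq_le z
    rw [← hu, ← hv] at hle
    have : (u - v) ^ 2 * ‖fC z‖ ^ 2 ≤ (u - v) ^ 2 * (u * v) := by gcongr
    have hpos : 0 < (u ^ 2 + v ^ 2) ^ 2 := by
      have : 0 < u ^ 2 + v ^ 2 := by
        rcases hu0.lt_or_eq with h | h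
        · positivity
        · have : 0 < v := by linarith
          positivity
      positivity
    nlinarith
  rintro ⟨α, β⟩
  -- The correction by `fDir` cancels the variation (u - v)f₊ that `bDir` produces in f₊; what is
  -- left in b is `M`.
  set y : C4 := (u + v) • bDir z - fDir ((u - v : ℝ) * fC z) z with hy
  have h3 : fderiv ℝ fbC z y = (0, M) := by
    rw [hy, map_sub, map_smul, h1, h2]
    refine Prod.ext ?_ ?_
    · apply Complex.ext <;> simp <;> ring
    · simp [hM, Complex.sq_norm, Complex.normSq_apply]; ring
  set l : ℂ := α / (u + v : ℝ) with hl
  have hl' : l * (u + v : ℝ) = α := div_mul_cancel₀ _ (by exact_mod_cast hR.ne')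
  refine ⟨fDir l z +
      ((β - 4 * (u - v) * (l * starRingEnd ℂ (fC z)).re) / M) • y, ?_⟩
  rw [map_add, map_smul, h1, h3, hl']
  refine Prod.ext ?_ ?_
  · simp
  · simp only [Prod.snd_add, Prod.smul_snd, smul_eq_mul]
    field_simp
    ring

lemma fderiv_fbC_Y1 (z : C4) : fderiv ℝ fbC z (Y1 z) = 0 := by
  rw [fderiv_fbC]
  refine Prod.ext ?_ ?_
  · apply Complex.ext <;> simp [dfC, Y1] <;> ring
  · simp [duC, dvC, Y1]
    ring

/-- The phase direction is transverse to the slice: at a point whose i-th coordinate is real and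
positive, `Y1` has a nonzero imaginary i-th component, which absorbs that of `w`. Since (f₊, b) is
constant along `Y1`, surjectivity survives restriction to the slice. -/
lemma exists_slice_add_Y1 (i : Fin 4) (p : Model) (hp : 0 < p.1) (w : C4) :
    ∃ (q : Model) (r : ℝ), w = slice i q + r • Y1 (slice i p) := by
  set r := (w i).im / p.1
  set w' := w - r • Y1 (slice i p)
  refine ⟨((w' i).re, fun j => w' (i.succAbove j)), r, ?_⟩
  have hw : w = w' + r • Y1 (slice i p) := by simp [w']
  rw [hw]
  congr 1
  ext k
  refine Fin.succAboveCases i ?_ (fun j => ?_) k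
  · have : (w' i).im = 0 := by
      simp [w', Y1, r]
      field_simp
      ring
    rw [slice_same]
    exact Complex.ext (by simp) (by simp [this])
  · rw [slice_succAbove]

lemma fderiv_fbC_slice_surjective (i : Fin 4) (p : Model) (hp : 0 < p.1) :
    Function.Surjective (fderiv ℝ (fun q => fbC (slice i q)) p) := by
  intro y
  obtain ⟨w, hw⟩ := fderiv_fbC_surjective (slice_ne_zero i p hp) y
  obtain ⟨q, r, hqr⟩ := exists_slice_add_Y1 i p hp w
  refine ⟨q, ?_⟩
  have h : HasFDerivAt (fun q => fbC (slice i q)) ((fderiv ℝ fbC (slice i p)).comp (slice i)) p :=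
    (contDiff_fbC.differentiable (by simp) _).hasFDerivAt.comp p (slice i).hasFDerivAt
  rw [h.fderiv, ← hw, hqr, map_add, map_smul, fderiv_fbC_Y1, smul_zero, add_zero]
  rfl

theorem isSubmanifold_level (f₀ : ℂ) (b : ℝ) :
    IsSubmanifold 4 {x | fPlus x = f₀ ∧ bFun x = b} := by
  intro x hx
  have hxp := mem_patch_index x
  set i := index x
  have hfb (y : Cone) (hy : y ∈ patch i) : fbC (slice i (coord i y)) = (fPlus y, bFun y) := by
    have h1 := localSection_ne_zero i hy
    have h2 := proj_localSection i hy
    conv_rhs => rw [← h2, fPlus_proj h1, bFun_proj h1]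
    rfl
  obtain ⟨e', he', hxe', hsub, -, L, hL, hmem⟩ := exists_slice_chart_of_surjective
    (chart_mem_maximalAtlas i) (x := x) hxp (F := fun q => fbC (slice i q)) (U := Set.univ)
    isOpen_univ trivial (contDiff_fbC.comp (slice i).contDiff).contDiffOn
    (fderiv_fbC_slice_surjective i (coord i x) hxp)
  refine ⟨e', he', hxe', L, ?_, fun y hy => ?_⟩
  · simp [Module.finrank_prod, Module.finrank_pi_fintype] at hL
    omega
  · rw [← hmem y hy]
    change _ ↔ fbC (slice i (coord i y)) = fbC (slice i (coord i x))
    rw [hfb y (hsub hy), hfb x hxp, Prod.mk.injEq, hx.1, hx.2]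
    rfl

/-! ### The three-form in a unitary frame -/

/-- The three-form in terms of the coordinates of three vectors subject to the equations of the
tangent space, and shifted by multiples of the generator of the phase action. -/
lemma frame_expand (c1 c2 f1 f2 : ℝ) (N : ℝ) (hN : N = c1 ^ 2 + c2 ^ 2 + f1 ^ 2 + f2 ^ 2)
    (x q k l s t : Fin 3 → ℝ) (p n m dR a2 a3 y : Fin 3 → ℝ) (a1 b2 b3 : Fin 3 → Fin 3 → ℝ)
    (hn : ∀ i, n i = k i * c1 - l i * c2 - N * x i * f1)
    (hm : ∀ i, m i = k i * c2 + l i * c1 - N * x i * f2)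
    (hp : ∀ i, p i = N * x i)
    (hdR : ∀ i, dR i = 2 * (1 + N) * x i)
    (ha1 : ∀ i j, a1 i j = p i * q j - q i * p j + k i * l j - l i * k j -
      ((s i + c2 * q i) * (t j - c1 * q j) - (t i - c1 * q i) * (s j + c2 * q j)) -
      ((n i + q i * f2) * (m j - q j * f1) - (m i - q i * f1) * (n j + q j * f2)))
    (ha2 : ∀ i, a2 i = s i - (c1 * p i) - (f1 * k i + f2 * l i))
    (ha3 : ∀ i, a3 i = t i + (-c2 * p i) + (f1 * l i - f2 * k i))
    (hb2 : ∀ i j, b2 i j = (s j + c2 * q j) * p i + (t j - c1 * q j) * q i +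
      (n j + q j * f2) * k i + (m j - q j * f1) * l i -
      ((s i + c2 * q i) * p j + (t i - c1 * q i) * q j + (n i + q i * f2) * k j +
      (m i - q i * f1) * l j))
    (hb3 : ∀ i j, b3 i j =
      -(((s j + c2 * q j) * q i - (t j - c1 * q j) * p i) +
      ((n j + q j * f2) * l i - (m j - q j * f1) * k i) -
      (((s i + c2 * q i) * q j - (t i - c1 * q i) * p j) +
      ((n i + q i * f2) * l j - (m i - q i * f1) * k j))))
    (hy : ∀ i, y i = c1 * s i + c2 * t i + (f1 * c1 + f2 * c2) * k i + (f2 * c1 - f1 * c2) * l i)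
    (γ : Fin 3 → Fin 3 → ℝ)
    (hγ : ∀ i j, γ i j =
      (4 * (1 + N * (f1 ^ 2 + f2 ^ 2)) + 2 * (f1 ^ 2 + f2 ^ 2)) * (k i * l j - k j * l i) +
      2 * (f2 * (k i * s j - k j * s i) - f1 * (k i * t j - k j * t i) -
        f1 * (l i * s j - l j * s i) - f2 * (l i * t j - l j * t i) -
        (s i * t j - s j * t i)) -
      4 * (1 + N) * (q i * y j - q j * y i)) :
    (2 * (1 + N) * dR 0 * a1 1 2 + dR 0 * (a2 1 * a3 2 - a2 2 * a3 1) +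
      2 * (1 + N) * (b2 0 1 * a3 2 - a2 0 * b3 1 2)) +
    (2 * (1 + N) * dR 1 * a1 2 0 + dR 1 * (a2 2 * a3 0 - a2 0 * a3 2) +
      2 * (1 + N) * (b2 1 2 * a3 0 - a2 1 * b3 2 0)) +
    (2 * (1 + N) * dR 2 * a1 0 1 + dR 2 * (a2 0 * a3 1 - a2 1 * a3 0) +
      2 * (1 + N) * (b2 2 0 * a3 1 - a2 2 * b3 0 1)) =
    (1 + N) * ((x 0 * γ 1 2 + x 1 * γ 2 0 + x 2 * γ 0 1)
      - 4 * (y 0 * (k 1 * l 2 - k 2 * l 1) + y 1 * (k 2 * l 0 - k 0 * l 2) +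
        y 2 * (k 0 * l 1 - k 1 * l 0))) := by
  simp only [hdR, ha1, ha2, ha3, hb2, hb3, hn, hm, hp, hγ, hy]
  subst hN
  ring

/-- The three-form vanishes on three vectors whose coordinates satisfy the equations of the tangent
space to a level set. -/
lemma frame_threeForm_eq_zero (c1 c2 f1 f2 : ℝ) (N D : ℝ)
    (hN : N = c1 ^ 2 + c2 ^ 2 + f1 ^ 2 + f2 ^ 2)
    (hD : D = 1 + N * (f1 ^ 2 + f2 ^ 2)) (hD0 : D ≠ 0)
    (p q k l s t n m dR a2 a3 : Fin 3 → ℝ) (a1 b2 b3 : Fin 3 → Fin 3 → ℝ)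
    (hn : ∀ i, n i = k i * c1 - l i * c2 - p i * f1 + q i * f2)
    (hm : ∀ i, m i = k i * c2 + l i * c1 - p i * f2 - q i * f1)
    (hp : ∀ i, p i = N * (c1 * s i + c2 * t i + f1 * n i + f2 * m i))
    (hdR : ∀ i, dR i = 2 * (p i + (c1 * s i + c2 * t i + f1 * n i + f2 * m i)))
    (ha1 : ∀ i j, a1 i j = p i * q j - q i * p j + k i * l j - l i * k j -
      (s i * t j - t i * s j) - (n i * m j - m i * n j))
    (ha2 : ∀ i, a2 i = s i - (c1 * p i + c2 * q i) - (f1 * k i + f2 * l i))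
    (ha3 : ∀ i, a3 i = t i + (c1 * q i - c2 * p i) + (f1 * l i - f2 * k i))
    (hb2 : ∀ i j, b2 i j = s j * p i + t j * q i + n j * k i + m j * l i -
      (s i * p j + t i * q j + n i * k j + m i * l j))
    (hb3 : ∀ i j, b3 i j =
      -((s j * q i - t j * p i) + (n j * l i - m j * k i) -
      ((s i * q j - t i * p j) + (n i * l j - m i * k j)))) :
    (2 * (1 + N) * dR 0 * a1 1 2 + dR 0 * (a2 1 * a3 2 - a2 2 * a3 1) +
      2 * (1 + N) * (b2 0 1 * a3 2 - a2 0 * b3 1 2)) +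
    (2 * (1 + N) * dR 1 * a1 2 0 + dR 1 * (a2 2 * a3 0 - a2 0 * a3 2) +
      2 * (1 + N) * (b2 1 2 * a3 0 - a2 1 * b3 2 0)) +
    (2 * (1 + N) * dR 2 * a1 0 1 + dR 2 * (a2 0 * a3 1 - a2 1 * a3 0) +
      2 * (1 + N) * (b2 2 0 * a3 1 - a2 2 * b3 0 1)) = 0 := by
  -- The generator `Y1` at z has frame coordinates (i, 0, -ic, -if). Subtracting q times it from
  -- each vector replaces s + it by σ + iτ.
  have hq : ∀ i, ∃ σ τ, s i = σ + c2 * q i ∧ t i = τ - c1 * q i := fun i =>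
    ⟨s i - c2 * q i, t i + c1 * q i, by ring, by ring⟩
  choose σ τ hσ hτ using hq
  obtain ⟨x, hx⟩ : ∃ x : Fin 3 → ℝ, ∀ i, x i = c1 * s i + c2 * t i + f1 * n i + f2 * m i :=
    ⟨_, fun i => rfl⟩
  have hpx : ∀ i, p i = N * x i := fun i => by rw [hp, hx]
  obtain ⟨y, hy⟩ : ∃ y : Fin 3 → ℝ, ∀ i, y i =
      c1 * σ i + c2 * τ i + (f1 * c1 + f2 * c2) * k i + (f2 * c1 - f1 * c2) * l i :=
    ⟨_, fun i => rfl⟩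
  -- Inserting df₊ = 0 into the definition of x brings back p = Nx with factor -|f|²; collecting the
  -- x terms produces D.
  have hxy : ∀ i, D * x i = y i := by
    intro i
    have h := hx i
    rw [hn, hm, hσ, hτ] at h
    rw [hD, hy]
    linear_combination h - (f1 ^ 2 + f2 ^ 2) * hpx i
  have hdR' : ∀ i, dR i = 2 * (1 + N) * x i := fun i => by
    rw [hdR, ← hx, hpx]; ring
  set γ : Fin 3 → Fin 3 → ℝ := fun i j =>
    (4 * (1 + N * (f1 ^ 2 + f2 ^ 2)) + 2 * (f1 ^ 2 + f2 ^ 2)) * (k i * l j - k j * l i) +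
    2 * (f2 * (k i * σ j - k j * σ i) - f1 * (k i * τ j - k j * τ i) - f1 * (l i * σ j - l j * σ i)
    - f2 * (l i * τ j - l j * τ i) - (σ i * τ j - σ j * τ i)) -
    4 * (1 + N) * (q i * y j - q j * y i) with hγ
  have hn' : ∀ i, n i = (k i * c1 - l i * c2 - N * x i * f1) + q i * f2 := fun i => by
    rw [hn, hpx]
  have hm' : ∀ i, m i = (k i * c2 + l i * c1 - N * x i * f2) - q i * f1 := fun i => by
    rw [hm, hpx]
  rw [frame_expand c1 c2 f1 f2 N hN x q k l σ τ p _ _ dR a2 a3 y a1 b2 b3 (fun i => rfl)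
    (fun i => rfl) hpx hdR' (fun i j => by rw [ha1, hσ, hσ, hτ, hτ, hn', hn', hm', hm'])
    (fun i => by rw [ha2, hσ]; ring) (fun i => by rw [ha3, hτ]; ring)
    (fun i j => by rw [hb2, hσ, hσ, hτ, hτ, hn', hn', hm', hm'])
    (fun i j => by rw [hb3, hσ, hσ, hτ, hτ, hn', hn', hm', hm']) hy γ (fun i j => rfl)]
  have key : D * ((x 0 * γ 1 2 + x 1 * γ 2 0 + x 2 * γ 0 1)
      - 4 * (y 0 * (k 1 * l 2 - k 2 * l 1) + y 1 * (k 2 * l 0 - k 0 * l 2) +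
        y 2 * (k 0 * l 1 - k 1 * l 0))) = 0 := by
    -- In terms of forms, γ - 4D k∧l = -2 P∧Q - 4(1 + N) q∧y, where P = σ + f₁k + f₂l and Q = τ +
    -- f₂k - f₁l. Since y = c₁P + c₂Q, the wedge product of y with this vanishes.
    have h : y 0 * γ 1 2 + y 1 * γ 2 0 + y 2 * γ 0 1 - 4 * D * (y 0 * (k 1 * l 2 - k 2 * l 1) +
        y 1 * (k 2 * l 0 - k 0 * l 2) + y 2 * (k 0 * l 1 - k 1 * l 0)) = 0 := by
      simp only [hγ, hD, hy]
      ring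
    linear_combination h + γ 1 2 * hxy 0 + γ 2 0 * hxy 1 + γ 0 1 * hxy 2
  rw [(mul_eq_zero.1 key).resolve_left hD0, mul_zero]

/-! ### An explicit formula for the three-form -/

lemma flat_apply (y w : C4) : flat y w = ∑ m, (starRingEnd ℂ (y m) * w m).re := by
  simp only [flat, sum_apply]
  refine Finset.sum_congr rfl fun m _ => ?_
  change inner ℝ (y m) (w m) = _
  rw [Complex.inner, mul_comm]

/-- Right multiplication by an imaginary unit is skew for the Euclidean metric. So each α = Y ⌟ e
has linear coefficients and dα(v, w) = 2e(Yv, w); the next two lemmas serve the same purpose. -/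
lemma flat_Y1_antisymm (y w : C4) : flat (Y1 y) w = -flat (Y1 w) y := by
  simp [flat_apply, Fin.sum_univ_four, Y1]
  ring

lemma flat_Y2_antisymm (y w : C4) : flat (Y2 y) w = -flat (Y2 w) y := by
  simp [flat_apply, Fin.sum_univ_four, Y2]
  ring

lemma flat_Y3_antisymm (y w : C4) : flat (Y3 y) w = -flat (Y3 w) y := by
  simp [flat_apply, Fin.sum_univ_four, Y3]
  ring

lemma hasFDerivAt_flat_left {Y : C4 → C4} (hY : ∀ y w, flat (Y y) w = -flat (Y w) y) (w z : C4) :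
    HasFDerivAt (fun y => flat (Y y) w) (-flat (Y w)) z := by
  have : (fun y => flat (Y y) w) = fun y => (-flat (Y w)) y := by
    ext y; exact hY y w
  rw [this]
  exact (-flat (Y w)).hasFDerivAt

lemma hasFDerivAt_R (z : C4) : HasFDerivAt R ((2 : ℝ) • flat z) z := by
  have h := HasFDerivAt.fun_sum (u := Finset.univ) fun (i : Fin 4) _ =>
    (hasFDerivAt_coord i z).norm_sq
  refine h.congr_fderiv ?_
  ext w
  simp [flat, Finset.mul_sum]
  exact Finset.sum_congr rfl fun i _ => by ring

lemma R_pos {z : C4} (hz : z ≠ 0) : 0 < R z := by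
  obtain ⟨i, hi⟩ := Function.ne_iff.1 hz
  have hi' : z i ≠ 0 := hi
  exact Finset.sum_pos' (fun _ _ => by positivity) ⟨i, Finset.mem_univ _, by positivity⟩

lemma contDiff_R : ContDiff ℝ ∞ R := by
  unfold R
  exact ContDiff.sum fun i _ => ContDiff.norm_sq ℝ (by fun_prop)

lemma contDiff_flat {Y : C4 → C4} (hY : ContDiff ℝ ∞ Y) : ContDiff ℝ ∞ fun z => flat (Y z) := by
  unfold flat
  refine ContDiff.sum fun i _ => ContDiff.clm_comp ?_ contDiff_const
  exact (innerSL ℝ : ℂ →L[ℝ] ℂ →L[ℝ] ℝ).contDiff.comp (contDiff_pi.1 hY i)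

lemma contDiff_Y1 : ContDiff ℝ ∞ Y1 := by
  unfold Y1; fun_prop

lemma contDiff_Y2 : ContDiff ℝ ∞ Y2 := by
  rw [contDiff_pi]
  intro i
  fin_cases i
  · exact (contDiff_conj_coord 1).neg
  · exact contDiff_conj_coord 0
  · exact (contDiff_conj_coord 3).neg
  · exact contDiff_conj_coord 2

lemma contDiff_Y3 : ContDiff ℝ ∞ Y3 := by
  rw [contDiff_pi]
  intro i
  fin_cases i
  · exact contDiff_const.mul (contDiff_conj_coord 1)
  · exact (contDiff_const.mul (contDiff_conj_coord 0)).neg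
  · exact contDiff_const.mul (contDiff_conj_coord 3)
  · exact (contDiff_const.mul (contDiff_conj_coord 2)).neg

lemma contDiffAt_alphaHat {Y : C4 → C4} (hY : ContDiff ℝ ∞ Y) {z : C4} (hz : z ≠ 0) :
    ContDiffAt ℝ ∞ (alphaHat Y) z :=
  (contDiff_R.contDiffAt.inv (R_pos hz).ne').smul (contDiff_flat hY).contDiffAt

lemma contDiffAt_oneForm {l : C4 → C4 →L[ℝ] ℝ} {z : C4} (hl : ContDiffAt ℝ ∞ l z) :
    ContDiffAt ℝ ∞ (fun y => oneForm (l y)) z :=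
  (ContinuousAlternatingMap.ofSubsingletonLIE (𝕜 := ℝ) (E := C4) (F := ℝ)
    (0 : Fin 1)).contDiff.contDiffAt.comp z hl

lemma contDiffAt_wedge {l m : C4 → C4 →L[ℝ] ℝ} {z : C4} (hl : ContDiffAt ℝ ∞ l z)
    (hm : ContDiffAt ℝ ∞ m z) : ContDiffAt ℝ ∞ (fun y => wedge (l y) (m y)) z := by
  have h : ContDiffAt ℝ ∞ (fun y => (l y).smulRight (oneForm (m y))) z :=
    hl.smulRight (contDiffAt_oneForm hm)
  have h' : ContDiff ℝ ∞ (ContinuousAlternatingMap.alternatizeUncurryFinCLM ℝ C4 ℝ (n := 1)) :=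
    ContinuousLinearMap.contDiff _
  exact h'.contDiffAt.comp z h

lemma contDiffAt_omega {z : C4} (hz : z ≠ 0) : ContDiffAt ℝ ∞ omega z := by
  have h1 : ContDiffAt ℝ ∞ (extDeriv (fun y => oneForm (alphaHat Y1 y))) z := by
    have h' : ContDiff ℝ ∞ (ContinuousAlternatingMap.alternatizeUncurryFinCLM ℝ C4 ℝ (n := 1)) :=
      ContinuousLinearMap.contDiff _
    exact h'.contDiffAt.comp z
      ((contDiffAt_oneForm (contDiffAt_alphaHat contDiff_Y1 hz)).fderiv_right (m := ∞) (by simp))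
  exact h1.add ((contDiffAt_wedge (contDiffAt_alphaHat contDiff_Y2 hz)
    (contDiffAt_alphaHat contDiff_Y3 hz)).const_smul (3 : ℝ))

lemma oneForm_apply (l : C4 →L[ℝ] ℝ) (v : Fin 1 → C4) : oneForm l v = l (v 0) := rfl

lemma fderiv_alphaHat_apply {Y : C4 → C4} (hY : ∀ y w, flat (Y y) w = -flat (Y w) y) {z : C4}
    (hz : z ≠ 0) (w d : C4) : fderiv ℝ (fun y => alphaHat Y y w) z d =
      (R z)⁻¹ * flat (Y d) w - (R z ^ 2)⁻¹ * (2 * flat z d) * flat (Y z) w := by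
  have h1 := (hasDerivAt_inv (R_pos hz).ne').comp_hasFDerivAt z (hasFDerivAt_R z)
  have h2 := h1.mul (hasFDerivAt_flat_left hY w z)
  rw [HasFDerivAt.fderiv (show HasFDerivAt (fun y => alphaHat Y y w) _ z from h2)]
  simp [hY d w]
  ring

/-- The value of `R³ω/3` on a pair of vectors. -/
def omegaFun (y a b : C4) : ℝ :=
  (2 / 3) * R y ^ 2 * flat (Y1 a) b -
    (1 / 3) * R y * (2 * flat y a * flat (Y1 y) b - 2 * flat y b * flat (Y1 y) a) +
    R y * (flat (Y2 y) a * flat (Y3 y) b - flat (Y2 y) b * flat (Y3 y) a)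

/-- With αₘ = Rα̂ₘ, the factor R³ clears the denominators: R³ω/3 = R²dα₁/3 - R dR∧α₁/3 + R α₂∧α₃. -/
lemma smul_omega_apply {z : C4} (hz : z ≠ 0) (v : Fin 2 → C4) :
    ((R z ^ 3 / 3) • omega z) v = omegaFun z (v 0) (v 1) := by
  have hR := (R_pos hz).ne'
  have hd : DifferentiableAt ℝ (fun y => oneForm (alphaHat Y1 y)) z :=
    (contDiffAt_oneForm (contDiffAt_alphaHat contDiff_Y1 hz)).differentiableAt (by simp)
  have hv : v = ![v 0, v 1] := by ext i; fin_cases i <;> rfl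
  have h1 : extDeriv (fun y => oneForm (alphaHat Y1 y)) z v =
      fderiv ℝ (fun y => alphaHat Y1 y (v 1)) z (v 0) -
        fderiv ℝ (fun y => alphaHat Y1 y (v 0)) z (v 1) := by
    rw [extDeriv_apply hd]
    simp [Fin.sum_univ_two, oneForm_apply, Fin.removeNth]
    ring
  have h2 : wedge (alphaHat Y2 z) (alphaHat Y3 z) v = alphaHat Y2 z (v 0) * alphaHat Y3 z (v 1) -
      alphaHat Y2 z (v 1) * alphaHat Y3 z (v 0) := by
    conv_lhs => rw [hv]
    exact wedge_apply _ _ _ _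
  rw [ContinuousAlternatingMap.smul_apply, omega, ContinuousAlternatingMap.add_apply,
    ContinuousAlternatingMap.smul_apply, h1, h2, fderiv_alphaHat_apply flat_Y1_antisymm hz,
    fderiv_alphaHat_apply flat_Y1_antisymm hz, flat_Y1_antisymm (v 1) (v 0)]
  simp only [alphaHat, smul_apply, smul_eq_mul, omegaFun]
  field_simp
  ring

lemma fderiv_omegaFun (z a b d : C4) : fderiv ℝ (fun y => omegaFun y a b) z d =
    (4 / 3) * R z * (2 * flat z d) * flat (Y1 a) b -
    (2 / 3) * flat z d * (2 * flat z a * flat (Y1 z) b - 2 * flat z b * flat (Y1 z) a) -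
    (1 / 3) * R z * (2 * flat d a * flat (Y1 z) b + 2 * flat z a * flat (Y1 d) b -
      2 * flat d b * flat (Y1 z) a - 2 * flat z b * flat (Y1 d) a) +
    2 * flat z d * (flat (Y2 z) a * flat (Y3 z) b - flat (Y2 z) b * flat (Y3 z) a) +
    R z * (flat (Y2 d) a * flat (Y3 z) b + flat (Y2 z) a * flat (Y3 d) b -
      flat (Y2 d) b * flat (Y3 z) a - flat (Y2 z) b * flat (Y3 d) a) := by
  have hsymm (y w : C4) : flat y w = flat w y := by
    simp only [flat_apply, Complex.mul_re, Complex.conj_re, Complex.conj_im]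
    exact Finset.sum_congr rfl fun i _ => by ring
  have hf (w : C4) : HasFDerivAt (fun y => flat y w) (flat w) z := by
    have : (fun y => flat y w) = fun y => flat w y := by ext y; exact hsymm y w
    rw [this]; exact (flat w).hasFDerivAt
  have h1 := fun w => hasFDerivAt_flat_left flat_Y1_antisymm w z
  have h2 := fun w => hasFDerivAt_flat_left flat_Y2_antisymm w z
  have h3 := fun w => hasFDerivAt_flat_left flat_Y3_antisymm w z
  have hR := hasFDerivAt_R z
  have h := ((((hR.pow 2).const_mul (2 / 3)).mul_const (flat (Y1 a) b)).sub
    ((hR.const_mul (1 / 3)).mul (((((hf a).const_mul 2).mul (h1 b))).sub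
      (((hf b).const_mul 2).mul (h1 a))))).add
    (hR.mul (((h2 a).mul (h3 b)).sub ((h2 b).mul (h3 a))))
  rw [HasFDerivAt.fderiv (show HasFDerivAt (fun y => omegaFun y a b) _ z from h)]
  simp [hsymm a d, hsymm b d, flat_Y1_antisymm d, flat_Y2_antisymm d, flat_Y3_antisymm d]
  ring

/-- The value of `φ` on three vectors, as a polynomial. -/
def phiFun (z : C4) (v : Fin 3 → C4) : ℝ :=
  (2 * R z * (2 * flat z (v 0)) * flat (Y1 (v 1)) (v 2) +
    2 * flat z (v 0) * (flat (Y2 z) (v 1) * flat (Y3 z) (v 2) -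
      flat (Y2 z) (v 2) * flat (Y3 z) (v 1)) +
    2 * R z * (flat (Y2 (v 0)) (v 1) * flat (Y3 z) (v 2) -
      flat (Y2 z) (v 0) * flat (Y3 (v 1)) (v 2))) +
  (2 * R z * (2 * flat z (v 1)) * flat (Y1 (v 2)) (v 0) +
    2 * flat z (v 1) * (flat (Y2 z) (v 2) * flat (Y3 z) (v 0) -
      flat (Y2 z) (v 0) * flat (Y3 z) (v 2)) +
    2 * R z * (flat (Y2 (v 1)) (v 2) * flat (Y3 z) (v 0) -
      flat (Y2 z) (v 1) * flat (Y3 (v 2)) (v 0))) +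
  (2 * R z * (2 * flat z (v 2)) * flat (Y1 (v 0)) (v 1) +
    2 * flat z (v 2) * (flat (Y2 z) (v 0) * flat (Y3 z) (v 1) -
      flat (Y2 z) (v 1) * flat (Y3 z) (v 0)) +
    2 * R z * (flat (Y2 (v 2)) (v 0) * flat (Y3 z) (v 1) -
      flat (Y2 z) (v 2) * flat (Y3 (v 0)) (v 1)))

/-- The derivative of R³ω/3 is R dR∧dα₁ + dR∧α₂∧α₃ + R(dα₂∧α₃ - α₂∧dα₃), and `phiFun` is its cyclic
expansion on three vectors. -/
theorem phiC4_apply {z : C4} (hz : z ≠ 0) (v : Fin 3 → C4) : phiC4 z v = phiFun z v := by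
  have hd : DifferentiableAt ℝ (fun y => (R y ^ 3 / 3) • omega y) z :=
    (((contDiff_R.pow 3).contDiffAt.div_const 3).smul (contDiffAt_omega hz)).differentiableAt
      (by simp)
  have hev (a b : C4) (w : Fin 2 → C4) (h0 : w 0 = a) (h1 : w 1 = b) :
      fderiv ℝ (fun y => ((R y ^ 3 / 3) • omega y) w) z = fderiv ℝ (fun y => omegaFun y a b) z := by
    apply Filter.EventuallyEq.fderiv_eq
    filter_upwards [isOpen_ne.mem_nhds hz] with y hy
    rw [smul_omega_apply hy, h0, h1]
  have hsymm (y w : C4) : flat y w = flat w y := by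
    simp only [flat_apply, Complex.mul_re, Complex.conj_re, Complex.conj_im]
    exact Finset.sum_congr rfl fun i _ => by ring
  rw [phiC4, extDeriv_apply hd, Fin.sum_univ_three, hev (v 1) (v 2) _ rfl rfl,
    hev (v 0) (v 2) _ rfl rfl, hev (v 0) (v 1) _ rfl rfl]
  simp only [fderiv_omegaFun, phiFun, flat_Y1_antisymm (v 1) (v 0), flat_Y1_antisymm (v 2) (v 0),
    flat_Y1_antisymm (v 2) (v 1), flat_Y2_antisymm (v 1) (v 0), flat_Y2_antisymm (v 2) (v 0),
    flat_Y2_antisymm (v 2) (v 1), flat_Y3_antisymm (v 1) (v 0), flat_Y3_antisymm (v 2) (v 0),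
    flat_Y3_antisymm (v 2) (v 1), hsymm (v 1) (v 0), hsymm (v 2) (v 0), hsymm (v 2) (v 1)]
  simp
  ring

/-! ### The three-form vanishes along the level sets -/

/-- The vector of `ℂ⁴` with coordinates `p, k, s, n` in the orthogonal frame defined by
`B ∈ ℂ²`. -/
def frameVec (B₀ B₁ p k s n : ℂ) : C4 :=
  ![p * B₀ - k * starRingEnd ℂ B₁, starRingEnd ℂ (s * B₀ - n * starRingEnd ℂ B₁),
    p * B₁ + k * starRingEnd ℂ B₀, starRingEnd ℂ (s * B₁ + n * starRingEnd ℂ B₀)]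

/-- The vectors (B₀, B₁) and (-B̄₁, B̄₀) are orthogonal and of equal length, hence a basis of ℂ². -/
lemma exists_frame_coords {B₀ B₁ : ℂ} (hB : 0 < ‖B₀‖ ^ 2 + ‖B₁‖ ^ 2) (x y : ℂ) :
    ∃ p k : ℂ, x = p * B₀ - k * starRingEnd ℂ B₁ ∧ y = p * B₁ + k * starRingEnd ℂ B₀ := by
  have h : (starRingEnd ℂ B₀ * B₀ + starRingEnd ℂ B₁ * B₁ : ℂ) ≠ 0 := by
    rw [Complex.conj_mul', Complex.conj_mul']
    exact_mod_cast hB.ne'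
  refine ⟨(starRingEnd ℂ B₀ * x + starRingEnd ℂ B₁ * y) /
    (starRingEnd ℂ B₀ * B₀ + starRingEnd ℂ B₁ * B₁), (B₀ * y - B₁ * x) /
    (starRingEnd ℂ B₀ * B₀ + starRingEnd ℂ B₁ * B₁), ?_, ?_⟩
  · field_simp; ring
  · field_simp; ring

lemma exists_eq_frameVec {B₀ B₁ : ℂ} (hB : 0 < ‖B₀‖ ^ 2 + ‖B₁‖ ^ 2) (w : C4) :
    ∃ p k s n : ℂ, w = frameVec B₀ B₁ p k s n := by
  obtain ⟨p, k, h0, h2⟩ := exists_frame_coords hB (w 0) (w 2)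
  obtain ⟨s, n, h1, h3⟩ := exists_frame_coords hB (starRingEnd ℂ (w 1)) (starRingEnd ℂ (w 3))
  refine ⟨p, k, s, n, ?_⟩
  ext i
  fin_cases i
  · exact h0
  · change w 1 = _
    rw [← Complex.conj_conj (w 1), h1]; rfl
  · exact h2
  · change w 3 = _
    rw [← Complex.conj_conj (w 3), h3]; rfl

/-! ### The metric, the forms and the differentials in the frame -/

section FrameVec

variable (B₀ B₁ p k s n p' k' s' n' : ℂ)

lemma flat_frameVec : flat (frameVec B₀ B₁ p k s n) (frameVec B₀ B₁ p' k' s' n') =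
    (‖B₀‖ ^ 2 + ‖B₁‖ ^ 2) * (p.re * p'.re + p.im * p'.im + k.re * k'.re + k.im * k'.im +
      s.re * s'.re + s.im * s'.im + n.re * n'.re + n.im * n'.im) := by
  simp [flat_apply, Fin.sum_univ_four, frameVec, Complex.sq_norm, Complex.normSq_apply]
  ring

lemma flat_Y1_frameVec : flat (Y1 (frameVec B₀ B₁ p k s n)) (frameVec B₀ B₁ p' k' s' n') =
    (‖B₀‖ ^ 2 + ‖B₁‖ ^ 2) * (p.re * p'.im - p.im * p'.re + k.re * k'.im - k.im * k'.re -
      (s.re * s'.im - s.im * s'.re) - (n.re * n'.im - n.im * n'.re)) := by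
  simp [flat_apply, Fin.sum_univ_four, frameVec, Y1, Complex.sq_norm, Complex.normSq_apply]
  ring

lemma flat_Y2_frameVec : flat (Y2 (frameVec B₀ B₁ p k s n)) (frameVec B₀ B₁ p' k' s' n') =
    (‖B₀‖ ^ 2 + ‖B₁‖ ^ 2) * (s'.re * p.re + s'.im * p.im + n'.re * k.re + n'.im * k.im -
      (s.re * p'.re + s.im * p'.im + n.re * k'.re + n.im * k'.im)) := by
  simp [flat_apply, Fin.sum_univ_four, frameVec, Y2, Complex.sq_norm, Complex.normSq_apply]
  ring

lemma flat_Y3_frameVec : flat (Y3 (frameVec B₀ B₁ p k s n)) (frameVec B₀ B₁ p' k' s' n') =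
    (‖B₀‖ ^ 2 + ‖B₁‖ ^ 2) * -((s'.re * p.im - s'.im * p.re) + (n'.re * k.im - n'.im * k.re) -
      ((s.re * p'.im - s.im * p'.re) + (n.re * k'.im - n.im * k'.re))) := by
  simp [flat_apply, Fin.sum_univ_four, frameVec, Y3, Complex.sq_norm, Complex.normSq_apply]
  ring

lemma dfC_frameVec : dfC (frameVec B₀ B₁ p k s n) (frameVec B₀ B₁ p' k' s' n') =
    (‖B₀‖ ^ 2 + ‖B₁‖ ^ 2 : ℝ) * (p' * n - k' * s + p * n' - k * s') := by
  push_cast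
  rw [← Complex.conj_mul', ← Complex.conj_mul']
  simp [dfC, frameVec]
  ring

lemma duC_frameVec : duC (frameVec B₀ B₁ p k s n) (frameVec B₀ B₁ p' k' s' n') =
    2 * ((‖B₀‖ ^ 2 + ‖B₁‖ ^ 2) * (p.re * p'.re + p.im * p'.im + k.re * k'.re + k.im * k'.im)) := by
  simp [duC, frameVec, Complex.sq_norm, Complex.normSq_apply]
  ring

lemma dvC_frameVec : dvC (frameVec B₀ B₁ p k s n) (frameVec B₀ B₁ p' k' s' n') =
    2 * ((‖B₀‖ ^ 2 + ‖B₁‖ ^ 2) * (s.re * s'.re + s.im * s'.im + n.re * n'.re + n.im * n'.im)) := by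
  simp [dvC, frameVec, Complex.sq_norm, Complex.normSq_apply]
  ring

lemma uC_frameVec : uC (frameVec B₀ B₁ p k s n) =
    (‖B₀‖ ^ 2 + ‖B₁‖ ^ 2) * (p.re ^ 2 + p.im ^ 2 + k.re ^ 2 + k.im ^ 2) := by
  simp [uC, frameVec, Complex.sq_norm, Complex.normSq_apply]
  ring

lemma vC_frameVec : vC (frameVec B₀ B₁ p k s n) =
    (‖B₀‖ ^ 2 + ‖B₁‖ ^ 2) * (s.re ^ 2 + s.im ^ 2 + n.re ^ 2 + n.im ^ 2) := by
  simp [vC, frameVec, Complex.sq_norm, Complex.normSq_apply]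
  ring

end FrameVec

lemma R_eq (z : C4) : R z = uC z + vC z := by
  simp [R, uC, vC, Fin.sum_univ_four]
  ring

/-- In the frame built on (z₀, z₂) the point itself has coordinates (1, 0, c, f). Every bilinear
quantity then carries a factor |z₀|² + |z₂|², so φ is its cube times the real expression treated in
`frame_threeForm_eq_zero`. -/
lemma phiFun_eq_zero_of_uC_pos {z : C4} (hz : 0 < uC z) (v : Fin 3 → C4)
    (hf : ∀ i, dfC z (v i) = 0) (hb : ∀ i, uC z * duC z (v i) = vC z * dvC z (v i)) :
    phiFun z v = 0 := by
  choose p k s n hv using fun i => exists_eq_frameVec hz (v i)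
  obtain ⟨c, f, h1, h3⟩ := exists_frame_coords (B₀ := z 0) (B₁ := z 2) hz (starRingEnd ℂ (z 1))
    (starRingEnd ℂ (z 3))
  have hz' : z = frameVec (z 0) (z 2) 1 0 c f := by
    ext i
    fin_cases i
    · simp [frameVec]
    · change z 1 = _
      rw [← Complex.conj_conj (z 1), h1]; rfl
    · simp [frameVec]
    · change z 3 = _
      rw [← Complex.conj_conj (z 3), h3]; rfl
  generalize z 0 = B₀ at *
  generalize z 2 = B₁ at *
  subst hz'
  obtain rfl : v = fun i => frameVec B₀ B₁ (p i) (k i) (s i) (n i) := funext hv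
  simp only [dfC_frameVec, duC_frameVec, dvC_frameVec, uC_frameVec, vC_frameVec] at hf hb hz
  have hu : 0 < ‖B₀‖ ^ 2 + ‖B₁‖ ^ 2 := by simpa using hz
  obtain ⟨u, hu'⟩ : ∃ u, u = ‖B₀‖ ^ 2 + ‖B₁‖ ^ 2 := ⟨_, rfl⟩
  rw [← hu'] at hf hb hu
  have hN : (0 : ℝ) ≤ c.re ^ 2 + c.im ^ 2 + f.re ^ 2 + f.im ^ 2 := by positivity
  have hf' (i) : p i * f - k i * c + n i = 0 := by
    have h := (mul_eq_zero.1 (hf i)).resolve_left (by exact_mod_cast hu.ne')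
    linear_combination h
  have hb' (i) : (p i).re = (c.re ^ 2 + c.im ^ 2 + f.re ^ 2 + f.im ^ 2) *
      (c.re * (s i).re + c.im * (s i).im + f.re * (n i).re + f.im * (n i).im) := by
    have h := hb i
    simp only [Complex.one_re, Complex.one_im, Complex.zero_re, Complex.zero_im] at h
    have : 2 * u ^ 2 ≠ 0 := by positivity
    refine mul_left_cancel₀ this ?_
    linear_combination h
  have main := frame_threeForm_eq_zero c.re c.im f.re f.im _ _ rfl rfl (by positivity)
    (fun i => (p i).re) (fun i => (p i).im) (fun i => (k i).re) (fun i => (k i).im)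
    (fun i => (s i).re) (fun i => (s i).im) (fun i => (n i).re) (fun i => (n i).im)
    _ _ _ _ _ _
    (fun i => by have h := congrArg Complex.re (hf' i); simp at h; linear_combination h)
    (fun i => by have h := congrArg Complex.im (hf' i); simp at h; linear_combination h)
    hb' (fun i => rfl) (fun i j => rfl) (fun i => rfl) (fun i => rfl) (fun i j => rfl)
    (fun i j => rfl)
  simp only [phiFun, R_eq, uC_frameVec, vC_frameVec, flat_frameVec, flat_Y1_frameVec,
    flat_Y2_frameVec, flat_Y3_frameVec, ← hu', Complex.one_re, Complex.one_im, Complex.zero_re,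
    Complex.zero_im]
  linear_combination u ^ 3 * main

/-- The involution of `ℂ⁴` exchanging `(z₀, z₂)` and `(z̄₁, z̄₃)`. -/
def swapC (z : C4) : C4 :=
  ![starRingEnd ℂ (z 1), starRingEnd ℂ (z 0), starRingEnd ℂ (z 3), starRingEnd ℂ (z 2)]

lemma uC_swapC (z : C4) : uC (swapC z) = vC z := by simp [uC, vC, swapC]

lemma vC_swapC (z : C4) : vC (swapC z) = uC z := by simp [uC, vC, swapC]

lemma duC_swapC (z w : C4) : duC (swapC z) (swapC w) = dvC z w := by simp [duC, dvC, swapC]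

lemma dvC_swapC (z w : C4) : dvC (swapC z) (swapC w) = duC z w := by simp [duC, dvC, swapC]

lemma dfC_swapC (z w : C4) : dfC (swapC z) (swapC w) = -dfC z w := by
  simp [dfC, swapC]
  ring

lemma flat_swapC (z w : C4) : flat (swapC z) (swapC w) = flat z w := by
  simp [flat_apply, swapC, Fin.sum_univ_four]
  ring

lemma flat_Y1_swapC (z w : C4) : flat (Y1 (swapC z)) (swapC w) = -flat (Y1 z) w := by
  simp [flat_apply, swapC, Fin.sum_univ_four, Y1]
  ring

lemma flat_Y2_swapC (z w : C4) : flat (Y2 (swapC z)) (swapC w) = -flat (Y2 z) w := by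
  simp [flat_apply, swapC, Fin.sum_univ_four, Y2]
  ring

lemma flat_Y3_swapC (z w : C4) : flat (Y3 (swapC z)) (swapC w) = flat (Y3 z) w := by
  simp [flat_apply, swapC, Fin.sum_univ_four, Y3]
  ring

/-- The involution preserves e and Y₃ and reverses Y₁ and Y₂, so α₁ and α₂∧α₃ both change sign while
R does not. -/
lemma phiFun_swapC (z : C4) (v : Fin 3 → C4) :
    phiFun (swapC z) (fun i => swapC (v i)) = -phiFun z v := by
  simp only [phiFun, R_eq, uC_swapC, vC_swapC, flat_swapC, flat_Y1_swapC, flat_Y2_swapC,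
    flat_Y3_swapC]
  ring

theorem phiFun_eq_zero {z : C4} (hz : z ≠ 0) (v : Fin 3 → C4)
    (hf : ∀ i, dfC z (v i) = 0) (hb : ∀ i, uC z * duC z (v i) = vC z * dvC z (v i)) :
    phiFun z v = 0 := by
  rcases (uC_nonneg z).lt_or_eq with h | h
  · exact phiFun_eq_zero_of_uC_pos h v hf hb
  -- At u = 0 there is no frame; the involution moves the point to one with u > 0, preserving both
  -- tangency equations.
  · have hv : 0 < vC z := by have := uC_add_vC_pos hz; linarith
    have := phiFun_eq_zero_of_uC_pos (z := swapC z) (by rwa [uC_swapC]) (fun i => swapC (v i))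
      (fun i => by rw [dfC_swapC, hf, neg_zero])
      (fun i => by rw [uC_swapC, vC_swapC, duC_swapC, dvC_swapC, hb])
    rwa [phiFun_swapC, neg_eq_zero] at this

/-- A curve in the level set, lifted by the local section, is one along which `fbC` is constant; the
chain rule gives the claim for its velocity. -/
lemma fderiv_fbC_tangentTo {f₀ : ℂ} {b : ℝ} {x : Cone} {i : Fin 4} (hx : x ∈ patch i)
    {v : TangentSpace 𝓘(ℝ, Model) x} (hv : v ∈ tangentTo {x | fPlus x = f₀ ∧ bFun x = b} x) :
    fderiv ℝ fbC (localSection i x) (mfderiv 𝓘(ℝ, Model) 𝓘(ℝ, C4) (localSection i) x v) = 0 := by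
  obtain ⟨γ, hγ, hW, rfl, rfl⟩ := hv
  have h1 : MDifferentiableAt 𝓘(ℝ, ℝ) 𝓘(ℝ, Model) γ 0 := hγ.mdifferentiableAt (by simp)
  have h2 : MDifferentiableAt 𝓘(ℝ, Model) 𝓘(ℝ, C4) (localSection i) (γ 0) :=
    (contMDiffAt_localSection i hx).mdifferentiableAt (by simp)
  have h3 : MDifferentiableAt 𝓘(ℝ, C4) 𝓘(ℝ, ℂ × ℝ) fbC (localSection i (γ 0)) :=
    (contDiff_fbC.differentiable (by simp) _).mdifferentiableAt
  have h4 := mfderiv_comp (0 : ℝ) h3 (h2.comp (0 : ℝ) h1)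
  have h5 := mfderiv_comp (0 : ℝ) h2 h1
  have hconst : fbC ∘ localSection i ∘ γ =ᶠ[𝓝 0] fun _ => (f₀, b) := by
    filter_upwards [hW, h1.continuousAt.eventually ((isOpen_patch i).mem_nhds hx)] with r hr hr'
    have hne := localSection_ne_zero i hr'
    change (fC (localSection i (γ r)), bC (localSection i (γ r))) = _
    rw [← fPlus_proj hne, ← bFun_proj hne, proj_localSection i hr', hr.1, hr.2]
  have h6 : mfderiv 𝓘(ℝ, ℝ) 𝓘(ℝ, ℂ × ℝ) (fbC ∘ localSection i ∘ γ) 0 = 0 := by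
    rw [hconst.mfderiv_eq, mfderiv_const]
    rfl
  have h7 := DFunLike.congr_fun (h4.symm.trans h6) (1 : ℝ)
  rw [h5, mfderiv_eq_fderiv] at h7
  exact h7

theorem isCoassociative_level (f₀ : ℂ) (b : ℝ) :
    IsCoassociative {x | fPlus x = f₀ ∧ bFun x = b} := by
  refine ⟨isSubmanifold_level f₀ b, fun x _ v hv => ?_⟩
  have hx := mem_patch_index x
  have hz := localSection_ne_zero _ hx
  have hker := fun m => fderiv_fbC_tangentTo hx (hv m)
  change phiC4 (localSection (index x) x) _ = 0
  rw [phiC4_apply hz]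
  have hker' := fun m => (fderiv_fbC _ _).symm.trans (hker m)
  refine phiFun_eq_zero hz _ (fun m => congrArg Prod.fst (hker' m)) fun m => ?_
  have h : 2 * uC _ * duC _ _ - 2 * vC _ * dvC _ _ = 0 := congrArg Prod.snd (hker' m)
  exact mul_left_cancel₀ two_ne_zero (by linear_combination h)

/-! ### The tangent bundle of the sphere as a submanifold of `ℝ³ × ℝ³` -/

/-- The Euclidean space of dimension 3. -/
abbrev E3 : Type := EuclideanSpace ℝ (Fin 3)

instance : Fact (Module.finrank ℝ E3 = 2 + 1) := ⟨finrank_euclideanSpace_fin⟩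

/-- The inclusion of the tangent bundle of the sphere in `ℝ³ × ℝ³`. -/
def inclTS2 (p : TangentBundle (𝓡 2) S2) : E3 × E3 :=
  (p.1, mfderiv (𝓡 2) 𝓘(ℝ, E3) ((↑) : S2 → E3) p.1 p.2)

lemma contMDiff_inclTS2 : ContMDiff (𝓡 2).tangent 𝓘(ℝ, E3 × E3) ∞ inclTS2 := by
  have hcoe : ContMDiff (𝓡 2) 𝓘(ℝ, E3) ∞ ((↑) : S2 → E3) := contMDiff_coe_sphere
  refine ContMDiff.prodMk_space ?_ ?_
  · exact hcoe.comp (Bundle.contMDiff_proj (TangentSpace (𝓡 2) (M := S2)))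
  · exact (contMDiff_snd_tangentBundle_modelSpace E3 𝓘(ℝ, E3)).comp
      (hcoe.contMDiff_tangentMap (m := ∞) (by simp))

lemma norm_inclTS2_fst (p : TangentBundle (𝓡 2) S2) : ‖(inclTS2 p).1‖ = 1 :=
  norm_eq_of_mem_sphere p.1

lemma inner_inclTS2 (p : TangentBundle (𝓡 2) S2) :
    inner ℝ (inclTS2 p).1 (inclTS2 p).2 = 0 := by
  rw [← Submodule.mem_orthogonal_singleton_iff_inner_right]
  have h := range_mfderiv_coe_sphere (n := 2) p.1
  have : (inclTS2 p).2 ∈ LinearMap.range (mfderiv (𝓡 2) 𝓘(ℝ, E3) ((↑) : S2 → E3) p.1).toLinearMap :=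
    ⟨p.2, rfl⟩
  exact (h ▸ this :)

lemma exists_inclTS2_eq {x ξ : E3} (hx : ‖x‖ = 1) (hξ : inner ℝ x ξ = 0) :
    ∃ p, inclTS2 p = (x, ξ) := by
  have h := range_mfderiv_coe_sphere (n := 2) (⟨x, by simpa using hx⟩ : S2)
  have h1 : ξ ∈ (Submodule.span ℝ {x})ᗮ :=
    Submodule.mem_orthogonal_singleton_iff_inner_right.2 hξ
  have h2 : ξ ∈ LinearMap.range (mfderiv (𝓡 2) 𝓘(ℝ, E3) ((↑) : S2 → E3)
    (⟨x, by simpa using hx⟩ : S2)).toLinearMap := (h ▸ h1 :)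
  obtain ⟨v, hv⟩ := h2
  exact ⟨⟨⟨x, by simpa using hx⟩, v⟩, Prod.ext rfl hv⟩

lemma injective_inclTS2 : Function.Injective inclTS2 := by
  rintro ⟨x, v⟩ ⟨y, w⟩ h
  obtain rfl : x = y := Subtype.ext (congrArg Prod.fst h)
  obtain rfl : v = w := mfderiv_coe_sphere_injective (n := 2) x (congrArg Prod.snd h)
  rfl

/-- The coordinates of the tangent bundle of the sphere near a point extend to an open set of the
ambient space. -/
lemma exists_extension_extChartAt (p : TangentBundle (𝓡 2) S2) :
    ∃ (κ : E3 × E3 → EuclideanSpace ℝ (Fin 2) × EuclideanSpace ℝ (Fin 2)) (V : Set (E3 × E3)),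
      IsOpen V ∧ inclTS2 p ∈ V ∧ ContDiffOn ℝ ∞ κ V ∧ ∀ q, inclTS2 q ∈ V →
        q ∈ (extChartAt (𝓡 2).tangent p).source ∧ κ (inclTS2 q) = extChartAt (𝓡 2).tangent p q := by
  -- The preferred chart at `p.1` is stereographic projection from the antipode. Its formula makes
  -- sense in ℝ³ off the plane ⟨v, x⟩ = 1, and paired with its differential it extends the chart of
  -- the tangent bundle.
  set v : S2 := -p.1 with hv
  set U := (OrthonormalBasis.fromOrthogonalSpanSingleton (𝕜 := ℝ) 2
    (ne_zero_of_mem_unit_sphere v)).repr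
  set e : E3 → EuclideanSpace ℝ (Fin 2) := fun x => U (stereoToFun (v : E3) x) with he
  set V₀ : Set E3 := {x | innerSL ℝ (v : E3) x ≠ 1} with hV₀
  have hV₀o : IsOpen V₀ := isOpen_ne_fun (innerSL ℝ (v : E3)).continuous continuous_const
  have hes : ContDiffOn ℝ ∞ e V₀ := U.contDiff.comp_contDiffOn contDiffOn_stereoToFun
  have hchart : ∀ x : S2, chartAt (EuclideanSpace ℝ (Fin 2)) p.1 x = e x := fun x => rfl
  have hsrc : ∀ x : S2, (x : E3) ∈ V₀ ↔ x ∈ (chartAt (EuclideanSpace ℝ (Fin 2)) p.1).source := by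
    intro x
    change _ ↔ x ∈ (stereographic' 2 v).source
    rw [stereographic'_source, Set.mem_compl_singleton_iff, ne_eq, sphere_ext_iff,
      real_inner_comm]
    rfl
  refine ⟨fun y => (e y.1, fderiv ℝ e y.1 y.2), V₀ ×ˢ Set.univ, hV₀o.prod isOpen_univ, ?_, ?_, ?_⟩
  · exact ⟨(hsrc p.1).2 (mem_chart_source _ _), trivial⟩
  · have h1 : ContDiffOn ℝ ∞ (fun y : E3 × E3 => e y.1) (V₀ ×ˢ Set.univ) :=
      hes.comp contDiff_fst.contDiffOn fun y hy => hy.1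
    have h2 : ContDiffOn ℝ ∞ (fun y : E3 × E3 => fderiv ℝ e y.1) (V₀ ×ˢ Set.univ) :=
      (hes.fderiv_of_isOpen hV₀o (by simp)).comp contDiff_fst.contDiffOn fun y hy => hy.1
    exact h1.prodMk (h2.clm_apply contDiff_snd.contDiffOn)
  · rintro q ⟨hq, -⟩
    have hq' := (hsrc q.1).1 hq
    refine ⟨?_, ?_⟩
    · rw [extChartAt_source, TangentBundle.mem_chart_source_iff]
      exact hq'
    · have h := tangentMap_chart (I := 𝓡 2) (p := p) (q := q) hq'
      have hd : mfderiv (𝓡 2) (𝓡 2) (chartAt (EuclideanSpace ℝ (Fin 2)) p.1) q.1 =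
          (fderiv ℝ e (q.1 : E3)).comp (mfderiv (𝓡 2) 𝓘(ℝ, E3) ((↑) : S2 → E3) q.1) := by
        rw [← mfderiv_eq_fderiv]
        exact mfderiv_comp (I' := 𝓘(ℝ, E3)) (g := e) q.1
          ((hes.contDiffAt (hV₀o.mem_nhds hq)).differentiableAt (by simp)).mdifferentiableAt
          ((contMDiff_coe_sphere (m := 1)).mdifferentiableAt (by simp))
      have h1 := congrArg (Bundle.TotalSpace.toProd _ _) h
      rw [Equiv.apply_symm_apply] at h1
      change _ = chartAt (ModelProd (EuclideanSpace ℝ (Fin 2)) (EuclideanSpace ℝ (Fin 2))) p q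
      rw [← h1]
      refine Prod.ext rfl ?_
      exact (DFunLike.congr_fun hd q.2).symm

/-- Every chart is the restriction of a continuous map on an open subset of ℝ³ × ℝ³, so
neighbourhoods in TS² are traces of ambient ones. -/
lemma isInducing_inclTS2 : Topology.IsInducing inclTS2 := by
  rw [Topology.isInducing_iff_nhds]
  intro p
  refine le_antisymm contMDiff_inclTS2.continuous.continuousAt.le_comap fun s hs => ?_
  obtain ⟨κ, V, hV, hpV, hκ, hκq⟩ := exists_extension_extChartAt p
  have h1 : (extChartAt (𝓡 2).tangent p).symm ⁻¹' s ∈ 𝓝 (κ (inclTS2 p)) := by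
    rw [(hκq p hpV).2]
    exact (continuousAt_extChartAt_symm (I := (𝓡 2).tangent) p).preimage_mem_nhds
      (by rwa [extChartAt_to_inv])
  have h2 := (hκ.continuousOn.continuousAt (hV.mem_nhds hpV)).preimage_mem_nhds h1
  refine ⟨_, Filter.inter_mem h2 (hV.mem_nhds hpV), ?_⟩
  rintro q ⟨hq1, hq2⟩
  have h3 : (extChartAt (𝓡 2).tangent p).symm (κ (inclTS2 q)) ∈ s := hq1
  rwa [(hκq q hq2).2, (extChartAt (𝓡 2).tangent p).left_inv (hκq q hq2).1] at h3

/-- A smooth map from the tangent bundle of the sphere which composes with a smooth map to the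
standard inclusion is a smooth embedding. -/
theorem isSmoothEmbedding_of_comp_eq_inclTS2 {g : TangentBundle (𝓡 2) S2 → Cone}
    (hg : ContMDiff (𝓡 2).tangent 𝓘(ℝ, Model) ∞ g) {L : Cone → E3 × E3} {V : Set Cone}
    (hV : IsOpen V) (hL : ContMDiffOn 𝓘(ℝ, Model) 𝓘(ℝ, E3 × E3) ∞ L V) (hgV : ∀ p, g p ∈ V)
    (hLg : ∀ p, L (g p) = inclTS2 p) :
    Manifold.IsSmoothEmbedding (𝓡 2).tangent 𝓘(ℝ, Model) ∞ g := by
  -- The complement is three-dimensional because 4 + 3 = 7. Only its dimension matters.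
  refine ⟨⟨E3, inferInstance, inferInstance, fun p => ?_⟩, ?_, ?_⟩
  · obtain ⟨κ, U, hU, hpU, hκ, hκq⟩ := exists_extension_extChartAt p
    refine isImmersionAtOfComplement_of_leftInverse ?_ hg (k := κ ∘ L) (V := V ∩ L ⁻¹' U)
      (hL.continuousOn.isOpen_inter_preimage hV hU) ⟨hgV p, ?_⟩ ?_ ?_
    · simp [Module.finrank_prod, Module.finrank_pi_fintype]
    · rw [Set.mem_preimage, hLg]; exact hpU
    · exact hκ.contMDiffOn.comp (hL.mono Set.inter_subset_left) fun y hy => hy.2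
    · filter_upwards [contMDiff_inclTS2.continuous.continuousAt.preimage_mem_nhds
        (hU.mem_nhds hpU)] with q hq
      rw [Function.comp_apply, hLg]
      exact (hκq q hq).2
  · rw [Topology.isInducing_iff_nhds]
    intro p
    refine le_antisymm hg.continuous.continuousAt.le_comap ?_
    rw [isInducing_inclTS2.nhds_eq_comap p]
    have h1 : Filter.Tendsto L (𝓝 (g p)) (𝓝 (inclTS2 p)) := by
      rw [← hLg]
      exact hL.continuousOn.continuousAt (hV.mem_nhds (hgV p))
    have h2 : inclTS2 = L ∘ g := funext fun q => (hLg q).symm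
    have h3 : Filter.comap inclTS2 (𝓝 (inclTS2 p)) =
        Filter.comap g (Filter.comap L (𝓝 (inclTS2 p))) := by
      rw [Filter.comap_comap, ← h2]
    rw [h3]
    exact Filter.comap_mono h1.le_comap
  · intro p q hpq
    apply injective_inclTS2
    rw [← hLg, ← hLg, hpq]

/-! ### Spinors -/

/-- The vector of `ℝ³` defined by a spinor in `ℂ²`. -/
def hopfVec (A₀ A₁ : ℂ) : E3 :=
  !₂[‖A₀‖ ^ 2 - ‖A₁‖ ^ 2, 2 * (A₀ * starRingEnd ℂ A₁).re, -2 * (A₀ * starRingEnd ℂ A₁).im]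

/-- The real part of the multiple by `c` of the null vector of `ℂ³` defined by a spinor. -/
def nullVec (c A₀ A₁ : ℂ) : E3 :=
  !₂[(c * (-2 * A₀ * A₁)).re, (c * (A₀ * A₀ - A₁ * A₁)).re,
    (c * (Complex.I * (A₀ * A₀ + A₁ * A₁))).re]

/-- The Hermitian product of a real vector with the null vector of `ℂ³` defined by a spinor. -/
def nullCoeff (ξ : E3) (A₀ A₁ : ℂ) : ℂ :=
  ξ 0 * starRingEnd ℂ (-2 * A₀ * A₁) + ξ 1 * starRingEnd ℂ (A₀ * A₀ - A₁ * A₁) +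
    ξ 2 * starRingEnd ℂ (Complex.I * (A₀ * A₀ + A₁ * A₁))

lemma norm_hopfVec (A₀ A₁ : ℂ) : ‖hopfVec A₀ A₁‖ = ‖A₀‖ ^ 2 + ‖A₁‖ ^ 2 := by
  rw [← sq_eq_sq₀ (norm_nonneg _) (by positivity), EuclideanSpace.norm_sq_eq]
  simp [Fin.sum_univ_three, hopfVec, Complex.sq_norm, Complex.normSq_apply]
  ring

lemma inner_hopfVec_nullVec (c A₀ A₁ : ℂ) : inner ℝ (hopfVec A₀ A₁) (nullVec c A₀ A₁) = 0 := by
  simp [PiLp.inner_apply, Fin.sum_univ_three, hopfVec, nullVec, Complex.sq_norm,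
    Complex.normSq_apply]
  ring

/-- For the null vector n of A, n·n = 0 and n·n̄ = 2|A|⁴, so pairing Re(cn) with n̄ leaves |A|⁴c. -/
lemma nullCoeff_nullVec (c A₀ A₁ : ℂ) :
    nullCoeff (nullVec c A₀ A₁) A₀ A₁ = ((‖A₀‖ ^ 2 + ‖A₁‖ ^ 2) ^ 2 : ℝ) * c := by
  apply Complex.ext
  · rw [Complex.re_ofReal_mul]
    simp [nullCoeff, nullVec, Complex.sq_norm, Complex.normSq_apply]
    ring
  · rw [Complex.im_ofReal_mul]
    simp [nullCoeff, nullVec, Complex.sq_norm, Complex.normSq_apply]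
    ring

/-- The real and imaginary parts of n, together with `hopfVec`, are orthogonal and all of length
|A|²; this is the expansion of ξ in that basis. -/
lemma nullVec_nullCoeff (ξ : E3) (A₀ A₁ : ℂ) :
    nullVec (nullCoeff ξ A₀ A₁) A₀ A₁ = (‖A₀‖ ^ 2 + ‖A₁‖ ^ 2) ^ 2 • ξ -
      inner ℝ (hopfVec A₀ A₁) ξ • hopfVec A₀ A₁ := by
  ext i
  fin_cases i <;>
  · simp [nullCoeff, nullVec, hopfVec, PiLp.inner_apply, Fin.sum_univ_three, Complex.sq_norm,
      Complex.normSq_apply]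
    ring

lemma norm_nullCoeff_sq (ξ : E3) (A₀ A₁ : ℂ) :
    ‖nullCoeff ξ A₀ A₁‖ ^ 2 =
      (‖A₀‖ ^ 2 + ‖A₁‖ ^ 2) ^ 2 * ‖ξ‖ ^ 2 - inner ℝ (hopfVec A₀ A₁) ξ ^ 2 := by
  rw [EuclideanSpace.norm_sq_eq]
  simp [nullCoeff, hopfVec, PiLp.inner_apply, Fin.sum_univ_three, Complex.sq_norm,
      Complex.normSq_apply]
  ring

lemma norm_nullVec_sq (c A₀ A₁ : ℂ) :
    ‖nullVec c A₀ A₁‖ ^ 2 = (‖A₀‖ ^ 2 + ‖A₁‖ ^ 2) ^ 2 * ‖c‖ ^ 2 := by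
  rw [EuclideanSpace.norm_sq_eq]
  simp [Fin.sum_univ_three, nullVec, Complex.sq_norm, Complex.normSq_apply]
  ring

/-- Spinors defining the same vector differ by a phase. -/
lemma exists_circle_of_hopfVec_eq {A₀ A₁ B₀ B₁ : ℂ} (hA : 0 < ‖A₀‖ ^ 2 + ‖A₁‖ ^ 2)
    (h : hopfVec A₀ A₁ = hopfVec B₀ B₁) :
    ∃ c : Circle, B₀ = (c : ℂ) * A₀ ∧ B₁ = (c : ℂ) * A₁ := by
  have hn : ‖A₀‖ ^ 2 + ‖A₁‖ ^ 2 = ‖B₀‖ ^ 2 + ‖B₁‖ ^ 2 := by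
    rw [← norm_hopfVec, h, norm_hopfVec]
  have h0 : ‖A₀‖ ^ 2 - ‖A₁‖ ^ 2 = ‖B₀‖ ^ 2 - ‖B₁‖ ^ 2 := congrArg (fun x : E3 => x 0) h
  have h1 : 2 * (A₀ * starRingEnd ℂ A₁).re = 2 * (B₀ * starRingEnd ℂ B₁).re :=
    congrArg (fun x : E3 => x 1) h
  have h2 : -2 * (A₀ * starRingEnd ℂ A₁).im = -2 * (B₀ * starRingEnd ℂ B₁).im :=
    congrArg (fun x : E3 => x 2) h
  have e0 : starRingEnd ℂ A₀ * A₀ = starRingEnd ℂ B₀ * B₀ := by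
    rw [Complex.conj_mul', Complex.conj_mul']
    have : ‖A₀‖ ^ 2 = ‖B₀‖ ^ 2 := by linarith
    exact_mod_cast this
  have e1 : starRingEnd ℂ A₁ * A₁ = starRingEnd ℂ B₁ * B₁ := by
    rw [Complex.conj_mul', Complex.conj_mul']
    have : ‖A₁‖ ^ 2 = ‖B₁‖ ^ 2 := by linarith
    exact_mod_cast this
  have e2 : A₀ * starRingEnd ℂ A₁ = B₀ * starRingEnd ℂ B₁ :=
    Complex.ext (by linarith) (by linarith)
  have e3 : starRingEnd ℂ A₀ * A₁ = starRingEnd ℂ B₀ * B₁ := by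
    have := congrArg (starRingEnd ℂ) e2
    simpa using this
  set d : ℂ := starRingEnd ℂ A₀ * A₀ + starRingEnd ℂ A₁ * A₁ with hd
  have hd' : d = (‖A₀‖ ^ 2 + ‖A₁‖ ^ 2 : ℝ) := by
    rw [hd, Complex.conj_mul', Complex.conj_mul']; push_cast; rfl
  have hd0 : d ≠ 0 := by rw [hd']; exact_mod_cast hA.ne'
  -- The equations above say that the Hermitian matrices AA* and BB* agree, so B is its own
  -- projection ⟨A, B⟩A/|A|² onto the line of A.
  set l : ℂ := (starRingEnd ℂ A₀ * B₀ + starRingEnd ℂ A₁ * B₁) / d with hl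
  have k0 : B₀ = l * A₀ := by
    rw [hl, div_mul_eq_mul_div, eq_div_iff hd0]
    linear_combination B₀ * hd - B₁ * e2 + B₀ * e1
  have k1 : B₁ = l * A₁ := by
    rw [hl, div_mul_eq_mul_div, eq_div_iff hd0]
    linear_combination B₁ * hd - B₀ * e3 + B₁ * e0
  have hl1 : ‖l‖ = 1 := by
    rw [k0, k1, norm_mul, norm_mul] at hn
    have : ‖l‖ ^ 2 = 1 := by
      refine mul_right_cancel₀ hA.ne' ?_
      linear_combination -hn
    exact (pow_eq_one_iff_of_nonneg (norm_nonneg l) two_ne_zero).1 this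
  exact ⟨⟨l, by simp [Submonoid.unitSphere, hl1]⟩, k0, k1⟩

/-- A unit vector is locally defined by a spinor depending smoothly on it. -/
lemma exists_spinor (x₀ : E3) : ∃ (A₀ A₁ : E3 → ℂ) (V : Set E3), IsOpen V ∧
    x₀ ∈ V ∧ ContDiffOn ℝ ∞ A₀ V ∧ ContDiffOn ℝ ∞ A₁ V ∧
      ∀ x ∈ V, ‖x‖ = 1 → hopfVec (A₀ x) (A₁ x) = x := by
  have hc (i : Fin 3) : ContDiff ℝ ∞ (fun x : E3 => x i) := by fun_prop
  have hsq (x : E3) (hx : ‖x‖ = 1) : x 0 ^ 2 + x 1 ^ 2 + x 2 ^ 2 = 1 := by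
    have := EuclideanSpace.norm_sq_eq x
    rw [hx] at this
    simp [Fin.sum_univ_three] at this
    linarith
  have hs (s : ℝ) (x : E3) (hx : 0 < 1 + s * x 0) :
      ContDiffAt ℝ ∞ (fun x : E3 => ((√((1 + s * x 0) / 2) : ℝ) : ℂ)) x :=
    Complex.ofRealCLM.contDiff.contDiffAt.comp x
      (((contDiff_const.add (contDiff_const.mul (hc 0))).div_const 2).contDiffAt.sqrt
        (by positivity))
  have hq (s : ℝ) (x : E3) (hx : 0 < 1 + s * x 0) : ContDiffAt ℝ ∞ (fun x : E3 =>
      ((x 1 : ℝ) + s * (x 2 : ℝ) * Complex.I : ℂ) / (2 * (√((1 + s * x 0) / 2) : ℝ))) x := by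
    have hne : 2 * ((√((1 + s * x 0) / 2) : ℝ) : ℂ) ≠ 0 := by
      have : √((1 + s * x 0) / 2) ≠ 0 := by positivity
      simpa using this
    have h1 (i : Fin 3) : ContDiffAt ℝ ∞ (fun x : E3 => ((x i : ℝ) : ℂ)) x :=
      (Complex.ofRealCLM.contDiff.comp (hc i)).contDiffAt
    simp only [div_eq_mul_inv]
    exact ((h1 1).add ((contDiffAt_const.mul (h1 2)).mul contDiffAt_const)).mul
      ((contDiffAt_const.mul (hs s x hx)).inv hne)
  have hopen (s : ℝ) : IsOpen {x : E3 | 0 < 1 + s * x 0} :=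
    isOpen_lt continuous_const (continuous_const.add (continuous_const.mul (hc 0).continuous))
  -- the product and the norms of the two components
  have hval (s : ℝ) (hss : s ^ 2 = 1) (x : E3) (hx : 0 < 1 + s * x 0) (hx1 : ‖x‖ = 1) :
      ‖((√((1 + s * x 0) / 2) : ℝ) : ℂ)‖ ^ 2 = (1 + s * x 0) / 2 ∧
      ‖((x 1 : ℝ) + s * (x 2 : ℝ) * Complex.I : ℂ) / (2 * (√((1 + s * x 0) / 2) : ℝ))‖ ^ 2 =
        (1 - s * x 0) / 2 ∧
      ((2 : ℝ) : ℂ) * ((√((1 + s * x 0) / 2) : ℝ) * (((x 1 : ℝ) + s * (x 2 : ℝ) * Complex.I : ℂ) /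
        (2 * (√((1 + s * x 0) / 2) : ℝ)))) = (x 1 : ℝ) + s * (x 2 : ℝ) * Complex.I := by
    have hr : √((1 + s * x 0) / 2) ^ 2 = (1 + s * x 0) / 2 := Real.sq_sqrt (by positivity)
    have hr0 : √((1 + s * x 0) / 2) ≠ 0 := by positivity
    generalize √((1 + s * x 0) / 2) = r at hr hr0
    refine ⟨?_, ?_, ?_⟩
    · rw [Complex.norm_real, Real.norm_eq_abs, sq_abs, hr]
    · rw [norm_div, div_pow, norm_mul, mul_pow, Complex.norm_real, Real.norm_eq_abs, sq_abs, hr,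
        Complex.sq_norm, Complex.normSq_apply]
      have := hsq x hx1
      simp
      field_simp
      linear_combination this + (x 2 ^ 2 + x 0 ^ 2) * hss
    · have : (r : ℂ) ≠ 0 := by exact_mod_cast hr0
      push_cast
      field_simp
  -- The Hopf fibration has no global section, so two are used, each smooth away from one pole: the
  -- sign `s` says which component of the spinor is taken real and positive.
  by_cases h : 0 < 1 + 1 * x₀ 0
  · refine ⟨_, _, {x | 0 < 1 + 1 * x 0}, hopen 1, h, fun x hx => (hs 1 x hx).contDiffWithinAt,
      fun x hx => (hq 1 x hx).contDiffWithinAt, fun x hx hx1 => ?_⟩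
    obtain ⟨h1, h2, h3⟩ := hval 1 (by norm_num) x hx hx1
    have h4 := congrArg (starRingEnd ℂ) h3
    rw [map_mul, map_mul, Complex.conj_ofReal, Complex.conj_ofReal] at h4
    have h5 := congrArg Complex.re h4
    have h6 := congrArg Complex.im h4
    rw [Complex.re_ofReal_mul] at h5
    rw [Complex.im_ofReal_mul] at h6
    ext i
    fin_cases i
    · change _ - _ = _
      rw [h1, h2]; simp; ring
    · change 2 * _ = _
      rw [h5]; simp
    · change -2 * _ = _
      rw [neg_mul, h6]; simp
  · have h' : 0 < 1 + -1 * x₀ 0 := by linarith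
    refine ⟨_, _, {x | 0 < 1 + -1 * x 0}, hopen (-1), h',
      fun x hx => (hq (-1) x hx).contDiffWithinAt,
      fun x hx => (hs (-1) x hx).contDiffWithinAt, fun x hx hx1 => ?_⟩
    obtain ⟨h1, h2, h3⟩ := hval (-1) (by norm_num) x hx hx1
    rw [mul_comm ((√_ : ℝ) : ℂ)] at h3
    have h5 := congrArg Complex.re h3
    have h6 := congrArg Complex.im h3
    rw [Complex.re_ofReal_mul] at h5
    rw [Complex.im_ofReal_mul] at h6
    ext i
    fin_cases i
    · change _ - _ = _
      rw [h1, h2]; simp; ring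
    · change 2 * (_ * starRingEnd ℂ _).re = _
      rw [Complex.conj_ofReal, h5]; simp
    · change -2 * (_ * starRingEnd ℂ _).im = _
      rw [Complex.conj_ofReal, neg_mul, h6]; simp

/-! ### The map from the cone to the tangent bundle of the sphere -/

/-- The Hermitian product of `(z₀, z₂)` and `(z̄₁, z̄₃)`. -/
def hermC (z : C4) : ℂ :=
  starRingEnd ℂ (z 0) * starRingEnd ℂ (z 1) + starRingEnd ℂ (z 2) * starRingEnd ℂ (z 3)

/-- The direction of `𝐮`, and a tangent vector to the sphere at that point. -/
def sphereMapC (z : C4) : E3 × E3 :=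
  ((uC z)⁻¹ • hopfVec (z 0) (z 2), (uC z)⁻¹ • nullVec (hermC z) (z 0) (z 2))

lemma uC_mul_vC (z : C4) : uC z * vC z = ‖fC z‖ ^ 2 + ‖hermC z‖ ^ 2 := by
  simp [uC, vC, fC, hermC, Complex.sq_norm, Complex.normSq_apply]
  ring

lemma hopfVec_smul (c : Circle) (A₀ A₁ : ℂ) :
    hopfVec ((c : ℂ) * A₀) ((c : ℂ) * A₁) = hopfVec A₀ A₁ := by
  simp only [hopfVec, conj_mul_circle, norm_mul, Circle.norm_coe, one_mul]

lemma uC_smul (c : Circle) (z : C4) : uC ((c : ℂ) • z) = uC z := by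
  simp only [uC, Pi.smul_apply, smul_eq_mul, norm_mul, Circle.norm_coe, one_mul]

lemma fC_smul (c : Circle) (z : C4) : fC ((c : ℂ) • z) = fC z := by
  simp only [fC, Pi.smul_apply, smul_eq_mul]
  rw [conj_mul_circle, mul_comm (starRingEnd ℂ _), conj_mul_circle, mul_comm (z 2)]

lemma nullVec_mul_mul (c l A₀ A₁ : ℂ) :
    nullVec c (l * A₀) (l * A₁) = nullVec (c * (l * l)) A₀ A₁ := by
  have h (i : Fin 3) : nullVec c (l * A₀) (l * A₁) i = nullVec (c * (l * l)) A₀ A₁ i := by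
    fin_cases i <;>
    · refine congrArg Complex.re ?_
      ring
  exact PiLp.ext h

lemma nullVec_real_smul (r : ℝ) (c A₀ A₁ : ℂ) : nullVec (c * r) A₀ A₁ = r • nullVec c A₀ A₁ := by
  have h (i : Fin 3) : nullVec (c * r) A₀ A₁ i = r * nullVec c A₀ A₁ i := by
    fin_cases i <;>
    · refine Eq.trans (congrArg Complex.re ?_) (Complex.re_ofReal_mul r _)
      ring
  exact PiLp.ext h

lemma hopfVec_real_mul (r : ℝ) (A₀ A₁ : ℂ) : hopfVec (r * A₀) (r * A₁) = r ^ 2 • hopfVec A₀ A₁ := by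
  ext i
  fin_cases i <;>
  · simp [hopfVec, mul_pow]
    ring

/-- Under a phase c, `hermC` has weight -2 and the null vector, being quadratic, has weight 2. Their
product is invariant, so `sphereMapC` descends to the cone. -/
lemma hermC_smul (c : Circle) (z : C4) : hermC ((c : ℂ) • z) * (c * c : ℂ) = hermC z := by
  have hc : starRingEnd ℂ (c : ℂ) * c = 1 := by
    rw [← Complex.normSq_eq_conj_mul_self]; simp
  simp only [hermC, Pi.smul_apply, smul_eq_mul, map_mul]
  linear_combination (starRingEnd ℂ (c : ℂ) * c + 1) * (starRingEnd ℂ (z 0) * starRingEnd ℂ (z 1) +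
    starRingEnd ℂ (z 2) * starRingEnd ℂ (z 3)) * hc

lemma sphereMapC_smul (c : Circle) (z : C4) : sphereMapC ((c : ℂ) • z) = sphereMapC z := by
  simp only [sphereMapC, uC_smul, Pi.smul_apply, smul_eq_mul, hopfVec_smul, nullVec_mul_mul,
    hermC_smul]

/-- The map from the cone to the tangent bundle of the sphere. -/
def sphereMap : Cone → E3 × E3 := descend sphereMapC sphereMapC_smul

lemma sphereMap_proj {z : C4} (hz : z ≠ 0) : sphereMap (proj z) = sphereMapC z :=
  descend_proj _ _ hz

lemma ne_zero_of_uC_pos {z : C4} (hz : 0 < uC z) : z ≠ 0 := by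
  rintro rfl
  simp [uC] at hz

lemma norm_sphereMapC_fst {z : C4} (hz : 0 < uC z) : ‖(sphereMapC z).1‖ = 1 := by
  change ‖(uC z)⁻¹ • hopfVec (z 0) (z 2)‖ = 1
  rw [norm_smul, norm_hopfVec, Real.norm_of_nonneg (by positivity)]
  exact inv_mul_cancel₀ hz.ne'

lemma inner_sphereMapC (z : C4) : inner ℝ (sphereMapC z).1 (sphereMapC z).2 = 0 := by
  change inner ℝ ((uC z)⁻¹ • hopfVec (z 0) (z 2)) ((uC z)⁻¹ • nullVec _ (z 0) (z 2)) = 0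
  rw [inner_smul_left, inner_smul_right, inner_hopfVec_nullVec, mul_zero, mul_zero]

/-- With `uC_mul_vC` this gives uv = |f₊|² + |ξ|², so f₊ and the tangent vector ξ determine uv. -/
lemma norm_sphereMapC_snd_sq {z : C4} (hz : 0 < uC z) :
    ‖(sphereMapC z).2‖ ^ 2 = ‖hermC z‖ ^ 2 := by
  change ‖(uC z)⁻¹ • nullVec (hermC z) (z 0) (z 2)‖ ^ 2 = _
  rw [norm_smul, mul_pow, norm_nullVec_sq, Real.norm_of_nonneg (by positivity)]
  change (uC z)⁻¹ ^ 2 * (uC z ^ 2 * _) = _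
  field_simp

lemma nullVec_hermC {z : C4} (hz : 0 < uC z) :
    nullVec (hermC z) (z 0) (z 2) = uC z • (sphereMapC z).2 := by
  change _ = uC z • (uC z)⁻¹ • nullVec (hermC z) (z 0) (z 2)
  rw [smul_inv_smul₀ hz.ne']

lemma hopfVec_eq_smul {z : C4} (hz : 0 < uC z) :
    hopfVec (z 0) (z 2) = uC z • (sphereMapC z).1 := by
  change _ = uC z • (uC z)⁻¹ • hopfVec (z 0) (z 2)
  rw [smul_inv_smul₀ hz.ne']

/-- Together with the next identity, this expands (z̄₁, z̄₃) in the orthogonal basis (z₀, z₂),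
(-z̄₂, z̄₀): the coefficients are h/u and f₊/u. -/
lemma uC_mul_conj_one (z : C4) :
    uC z * starRingEnd ℂ (z 1) = hermC z * z 0 - fC z * starRingEnd ℂ (z 2) := by
  rw [uC]
  push_cast
  rw [← Complex.conj_mul', ← Complex.conj_mul', hermC, fC]
  ring

lemma uC_mul_conj_three (z : C4) :
    uC z * starRingEnd ℂ (z 3) = hermC z * z 2 + fC z * starRingEnd ℂ (z 0) := by
  rw [uC]
  push_cast
  rw [← Complex.conj_mul', ← Complex.conj_mul', hermC, fC]
  ring

/-- The functions `f₊`, `b` and the map to the tangent bundle of the sphere separate the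
points. -/
lemma proj_eq_of_sphereMapC_eq {z y : C4} (hz : 0 < uC z) (hy : 0 < uC y) (hf : fC z = fC y)
    (hb : bC z = bC y) (hs : sphereMapC z = sphereMapC y) : proj z = proj y := by
  have hc : ‖hermC z‖ ^ 2 = ‖hermC y‖ ^ 2 := by
    rw [← norm_sphereMapC_snd_sq hz, hs, norm_sphereMapC_snd_sq hy]
  have huv : uC z * vC z = uC y * vC y := by rw [uC_mul_vC, uC_mul_vC, hf, hc]
  have hu : uC z = uC y := by
    rw [← sq_eq_sq₀ hz.le hy.le]
    by_contra hne
    rw [bC, bC] at hb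
    -- Eliminating v from uv = P and u² - v² = b leaves a quadratic in u² with at most one positive
    -- root.
    have h1 : (uC z ^ 2 - uC y ^ 2) * (uC z ^ 2 + vC y ^ 2) = 0 := by
      linear_combination uC z ^ 2 * hb + (uC z * vC z + uC y * vC y) * huv
    rcases mul_eq_zero.1 h1 with h | h
    · exact hne (sub_eq_zero.1 h)
    · have : 0 < uC z ^ 2 := by positivity
      nlinarith [sq_nonneg (vC y)]
  obtain ⟨c, h0, h2⟩ := exists_circle_of_hopfVec_eq (A₀ := z 0) (A₁ := z 2) (B₀ := y 0)
    (B₁ := y 2) hz (by rw [hopfVec_eq_smul hz, hopfVec_eq_smul hy, hu, hs])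
  rw [← proj_smul c z (ne_zero_of_uC_pos hz)]
  congr 1
  -- After rotating z by the phase c, both points share (z₀, z₂). It remains to recover h from ξ
  -- through `nullCoeff`, and then the other two coordinates from f₊ and h.
  rw [← uC_smul c] at hz hu
  rw [← fC_smul c] at hf
  rw [← sphereMapC_smul c] at hs
  replace h0 : ((c : ℂ) • z) 0 = y 0 := h0.symm
  replace h2 : ((c : ℂ) • z) 2 = y 2 := h2.symm
  generalize (c : ℂ) • z = w at *
  have hu' : ((uC y : ℝ) : ℂ) ≠ 0 := by exact_mod_cast hy.ne'
  have hcw : hermC w = hermC y := by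
    have k1 := nullCoeff_nullVec (hermC w) (w 0) (w 2)
    have k2 := nullCoeff_nullVec (hermC y) (y 0) (y 2)
    rw [nullVec_hermC hz, hs, hu, h0, h2, ← nullVec_hermC hy, k2] at k1
    refine (mul_left_cancel₀ ?_ k1).symm
    have : (‖y 0‖ ^ 2 + ‖y 2‖ ^ 2) ^ 2 ≠ 0 := pow_ne_zero 2 hy.ne'
    exact_mod_cast this
  have k1 := uC_mul_conj_one w
  have k3 := uC_mul_conj_three w
  rw [hu, hcw, hf, h0, h2, ← uC_mul_conj_one] at k1
  rw [hu, hcw, hf, h0, h2, ← uC_mul_conj_three] at k3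
  ext i
  fin_cases i
  · exact h0
  · exact (starRingEnd ℂ).injective (mul_left_cancel₀ hu' k1)
  · exact h2
  · exact (starRingEnd ℂ).injective (mul_left_cancel₀ hu' k3)

/-! ### The map from the tangent bundle of the sphere to the cone -/

/-- The value of `u` in terms of `P = uv` and `b = u² - v²`. -/
def uOf (b P : ℝ) : ℝ := √((b + √(b ^ 2 + 4 * P ^ 2)) / 2)

/-- For P ≥ 0 the hypothesis excludes only P = 0 with b ≤ 0, where the formula for u gives 0. -/
lemma sq_add_pos {b P : ℝ} (h : 0 < P ∨ 0 < b) : 0 < b ^ 2 + 4 * P ^ 2 := by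
  rcases h with h | h <;> positivity

lemma add_sqrt_pos {b P : ℝ} (h : 0 < P ∨ 0 < b) : 0 < b + √(b ^ 2 + 4 * P ^ 2) := by
  rcases h with h | h
  · have h1 : |b| < √(b ^ 2 + 4 * P ^ 2) := by
      rw [← Real.sqrt_sq_eq_abs]
      exact Real.sqrt_lt_sqrt (sq_nonneg b) (by nlinarith)
    linarith [neg_abs_le b]
  · positivity

lemma uOf_pos {b P : ℝ} (h : 0 < P ∨ 0 < b) : 0 < uOf b P :=
  Real.sqrt_pos.2 (half_pos (add_sqrt_pos h))

lemma uOf_sq_sub {b P : ℝ} (h : 0 < P ∨ 0 < b) : uOf b P ^ 2 - (P / uOf b P) ^ 2 = b := by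
  have h0 := add_sqrt_pos h
  have h1 : uOf b P ^ 2 = (b + √(b ^ 2 + 4 * P ^ 2)) / 2 := Real.sq_sqrt (half_pos h0).le
  have h2 : √(b ^ 2 + 4 * P ^ 2) ^ 2 = b ^ 2 + 4 * P ^ 2 := Real.sq_sqrt (sq_add_pos h).le
  rw [div_pow, h1]
  field_simp
  linear_combination h2

lemma contDiffAt_uOf {b P : ℝ} (h : 0 < P ∨ 0 < b) : ContDiffAt ℝ ∞ (uOf b) P := by
  have h1 : ContDiffAt ℝ ∞ (fun P : ℝ => b ^ 2 + 4 * P ^ 2) P := by fun_prop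
  exact ((contDiffAt_const.add (h1.sqrt (sq_add_pos h).ne')).div_const 2).sqrt
    (half_pos (add_sqrt_pos h)).ne'

/-- The point of `ℂ⁴` over a tangent vector `ξ` to the sphere, at the point defined by the spinor
`(S₀, S₁)`, at which `f₊` and `b` have the given values. -/
def liftC (f₀ : ℂ) (b : ℝ) (ξ : E3) (S₀ S₁ : ℂ) : C4 :=
  frameVec S₀ S₁ (√(uOf b (‖f₀‖ ^ 2 + ‖ξ‖ ^ 2)) : ℝ) 0
    (nullCoeff ξ S₀ S₁ / (√(uOf b (‖f₀‖ ^ 2 + ‖ξ‖ ^ 2)) : ℝ))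
    (f₀ / (√(uOf b (‖f₀‖ ^ 2 + ‖ξ‖ ^ 2)) : ℝ))

lemma fC_frameVec (B₀ B₁ p k s n : ℂ) :
    fC (frameVec B₀ B₁ p k s n) = (‖B₀‖ ^ 2 + ‖B₁‖ ^ 2 : ℝ) * (p * n - k * s) := by
  push_cast
  rw [← Complex.conj_mul', ← Complex.conj_mul']
  simp [fC, frameVec]
  ring

/-- With |S| = 1, the lift has A = √u S, and (z̄₁, z̄₃) has components c/√u and f₀/√u along S and
its rotation, where c = `nullCoeff ξ S₀ S₁`. Hence h = c, the determinant is f₀, and v = (|f₀|² +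
|ξ|²)/u, which is the relation solved by `uOf`. -/
lemma liftC_spec {f₀ : ℂ} {b : ℝ} {x ξ : E3} {S₀ S₁ : ℂ} (hx : ‖x‖ = 1) (hξ : inner ℝ x ξ = 0)
    (hS : hopfVec S₀ S₁ = x) (h : 0 < ‖f₀‖ ^ 2 + ‖ξ‖ ^ 2 ∨ 0 < b) :
    0 < uC (liftC f₀ b ξ S₀ S₁) ∧ fC (liftC f₀ b ξ S₀ S₁) = f₀ ∧ bC (liftC f₀ b ξ S₀ S₁) = b ∧
      sphereMapC (liftC f₀ b ξ S₀ S₁) = (x, ξ) := by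
  have hn : ‖S₀‖ ^ 2 + ‖S₁‖ ^ 2 = 1 := by rw [← norm_hopfVec, hS, hx]
  have hU := uOf_pos h
  have hUb := uOf_sq_sub h
  have hc : ‖nullCoeff ξ S₀ S₁‖ ^ 2 = ‖ξ‖ ^ 2 := by
    rw [norm_nullCoeff_sq, hn, hS, hξ]; ring
  have hr := Real.sq_sqrt hU.le
  have hr0 := Real.sqrt_pos.2 hU
  have hnull := nullVec_nullCoeff ξ S₀ S₁
  rw [hn, hS, hξ, one_pow, one_smul, zero_smul, sub_zero] at hnull
  have huC : uC (liftC f₀ b ξ S₀ S₁) = uOf b (‖f₀‖ ^ 2 + ‖ξ‖ ^ 2) := by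
    rw [liftC, uC_frameVec, hn]
    simp [hr]
  rw [liftC] at *
  set r := √(uOf b (‖f₀‖ ^ 2 + ‖ξ‖ ^ 2)) with hrdef
  set U := uOf b (‖f₀‖ ^ 2 + ‖ξ‖ ^ 2) with hUdef
  set c := nullCoeff ξ S₀ S₁ with hcdef
  have hrC : (r : ℂ) ≠ 0 := by exact_mod_cast hr0.ne'
  have hvC : vC (frameVec S₀ S₁ r 0 (c / r) (f₀ / r)) = (‖f₀‖ ^ 2 + ‖ξ‖ ^ 2) / U := by
    have e (w : ℂ) : w.re ^ 2 + w.im ^ 2 = ‖w‖ ^ 2 := by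
      rw [Complex.sq_norm, Complex.normSq_apply]; ring
    rw [vC_frameVec, hn, add_assoc, e, e, norm_div, norm_div, Complex.norm_real, div_pow, div_pow,
      Real.norm_eq_abs, sq_abs, hr, hc]
    ring
  refine ⟨huC ▸ hU, ?_, ?_, ?_⟩
  · rw [fC_frameVec, hn]
    field_simp
    simp
  · rw [bC, huC, hvC, hUb]
  · have hherm : hermC (frameVec S₀ S₁ r 0 (c / r) (f₀ / r)) = c := by
      have h2 : starRingEnd ℂ S₀ * S₀ + starRingEnd ℂ S₁ * S₁ = 1 := by
        rw [Complex.conj_mul', Complex.conj_mul']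
        exact_mod_cast hn
      simp [hermC, frameVec]
      field_simp
      linear_combination c * h2
    have h0 : frameVec S₀ S₁ r 0 (c / r) (f₀ / r) 0 = r * S₀ := by simp [frameVec]
    have h1 : frameVec S₀ S₁ r 0 (c / r) (f₀ / r) 2 = r * S₁ := by simp [frameVec]
    rw [sphereMapC, huC, hherm, h0, h1, hopfVec_real_mul, nullVec_mul_mul, ← Complex.ofReal_mul,
      nullVec_real_smul, ← pow_two, hr, hS, hnull, inv_smul_smul₀ hU.ne', inv_smul_smul₀ hU.ne']

lemma contDiffAt_liftC {f₀ : ℂ} {b : ℝ} {A₀ A₁ : E3 → ℂ} {y : E3 × E3}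
    (h : 0 < ‖f₀‖ ^ 2 + ‖y.2‖ ^ 2 ∨ 0 < b) (h0 : ContDiffAt ℝ ∞ A₀ y.1)
    (h1 : ContDiffAt ℝ ∞ A₁ y.1) :
    ContDiffAt ℝ ∞ (fun y : E3 × E3 => liftC f₀ b y.2 (A₀ y.1) (A₁ y.1)) y := by
  have hr : ContDiffAt ℝ ∞ (fun y : E3 × E3 =>
      ((√(uOf b (‖f₀‖ ^ 2 + ‖y.2‖ ^ 2)) : ℝ) : ℂ)) y := by
    have e : ContDiffAt ℝ ∞ (fun y : E3 × E3 => ‖f₀‖ ^ 2 + ‖y.2‖ ^ 2) y :=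
      contDiffAt_const.add (contDiff_snd.norm_sq ℝ).contDiffAt
    have hU : ContDiffAt ℝ ∞ (fun y : E3 × E3 => uOf b (‖f₀‖ ^ 2 + ‖y.2‖ ^ 2)) y :=
      ContDiffAt.comp y (g := uOf b) (contDiffAt_uOf h) e
    exact Complex.ofRealCLM.contDiff.contDiffAt.comp y (hU.sqrt (uOf_pos h).ne')
  have hr0 : ((√(uOf b (‖f₀‖ ^ 2 + ‖y.2‖ ^ 2)) : ℝ) : ℂ) ≠ 0 := by
    exact_mod_cast (Real.sqrt_pos.2 (uOf_pos h)).ne'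
  have h0' : ContDiffAt ℝ ∞ (fun y : E3 × E3 => A₀ y.1) y := h0.comp y contDiffAt_fst
  have h1' : ContDiffAt ℝ ∞ (fun y : E3 × E3 => A₁ y.1) y := h1.comp y contDiffAt_fst
  have conj {g : E3 × E3 → ℂ} (hg : ContDiffAt ℝ ∞ g y) :
      ContDiffAt ℝ ∞ (fun y => starRingEnd ℂ (g y)) y :=
    Complex.conjCLE.contDiff.contDiffAt.comp y hg
  have hξ (i : Fin 3) : ContDiffAt ℝ ∞ (fun y : E3 × E3 => ((y.2 i : ℝ) : ℂ)) y :=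
    Complex.ofRealCLM.contDiff.contDiffAt.comp y (by fun_prop)
  have hc : ContDiffAt ℝ ∞ (fun y : E3 × E3 => nullCoeff y.2 (A₀ y.1) (A₁ y.1)) y := by
    unfold nullCoeff
    exact (((hξ 0).mul (conj ((contDiffAt_const.mul h0').mul h1'))).add
      ((hξ 1).mul (conj ((h0'.mul h0').sub (h1'.mul h1'))))).add
      ((hξ 2).mul (conj (contDiffAt_const.mul ((h0'.mul h0').add (h1'.mul h1')))))
  have hs := hc.mul (hr.inv hr0)
  have hn := (contDiffAt_const (c := f₀)).mul (hr.inv hr0)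
  unfold liftC frameVec
  simp only [div_eq_mul_inv]
  refine contDiffAt_pi.2 fun i => ?_
  fin_cases i
  · exact (hr.mul h0').sub (contDiffAt_const.mul (conj h1'))
  · exact conj ((hs.mul h0').sub (hn.mul (conj h1')))
  · exact (hr.mul h1').add (contDiffAt_const.mul (conj h0'))
  · exact conj ((hs.mul h1').add (hn.mul (conj h0')))

/-! ### The level sets -/

theorem nonempty_level (f₀ : ℂ) (b : ℝ) : {x | fPlus x = f₀ ∧ bFun x = b}.Nonempty := by
  have hS : ‖hopfVec 1 0‖ = 1 := by simp [norm_hopfVec]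
  have hξ : inner ℝ (hopfVec 1 0) (nullVec 1 1 0) = 0 := inner_hopfVec_nullVec 1 1 0
  -- A nonzero tangent vector makes P positive for all f₀ and b, so the lift also exists over (0,
  -- 0).
  have h : 0 < ‖nullVec 1 1 0‖ ^ 2 := by simp [norm_nullVec_sq]
  obtain ⟨h1, h2, h3, -⟩ := liftC_spec (f₀ := f₀) (b := b) hS hξ rfl (Or.inl (by positivity))
  have hz := ne_zero_of_uC_pos h1
  exact ⟨proj _, (fPlus_proj hz).trans h2, (bFun_proj hz).trans h3⟩

/-- At u = 0 one has f₊ = 0 and b = -v² ≤ 0. -/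
lemma uC_pos_of_level {z : C4} {f₀ : ℂ} {b : ℝ} (h : f₀ ≠ 0 ∨ 0 < b) (hf : fC z = f₀)
    (hb : bC z = b) : 0 < uC z := by
  refine (uC_nonneg z).lt_of_ne' fun h0 => ?_
  have h1 := norm_fC_sq_le z
  rw [bC, h0] at hb
  rw [h0, hf, zero_mul] at h1
  rcases h with h | h
  · have := norm_pos_iff.2 h
    nlinarith
  · nlinarith [sq_nonneg (vC z)]

/-- The points of the cone at which `u` is positive. -/
def uPos : Set Cone := patch 0 ∪ patch 2

lemma isOpen_uPos : IsOpen uPos := (isOpen_patch 0).union (isOpen_patch 2)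

lemma proj_mem_uPos {z : C4} (hz : z ≠ 0) : proj z ∈ uPos ↔ 0 < uC z := by
  rw [proj_of_ne hz, uC_pos_iff]
  exact or_congr (mem_patch_toCone 0 _) (mem_patch_toCone 2 _)

lemma contDiffAt_sphereMapC {z : C4} (hz : 0 < uC z) : ContDiffAt ℝ ∞ sphereMapC z := by
  have hi := contDiff_uC.contDiffAt.inv hz.ne'
  have hc (i : Fin 4) : ContDiff ℝ ∞ (fun z : C4 => z i) := by fun_prop
  have re {g : C4 → ℂ} (hg : ContDiff ℝ ∞ g) : ContDiff ℝ ∞ (fun y => (g y).re) :=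
    Complex.reCLM.contDiff.comp hg
  have im {g : C4 → ℂ} (hg : ContDiff ℝ ∞ g) : ContDiff ℝ ∞ (fun y => (g y).im) :=
    Complex.imCLM.contDiff.comp hg
  have hh : ContDiff ℝ ∞ hermC := ((contDiff_conj_coord 0).mul (contDiff_conj_coord 1)).add
    ((contDiff_conj_coord 2).mul (contDiff_conj_coord 3))
  have h1 : ContDiff ℝ ∞ (fun z : C4 => hopfVec (z 0) (z 2)) := by
    refine contDiff_euclidean.2 fun i => ?_
    fin_cases i
    · exact ((hc 0).norm_sq ℝ).sub ((hc 2).norm_sq ℝ)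
    · exact contDiff_const.mul (re ((hc 0).mul (contDiff_conj_coord 2)))
    · exact contDiff_const.mul (im ((hc 0).mul (contDiff_conj_coord 2)))
  have h2 : ContDiff ℝ ∞ (fun z : C4 => nullVec (hermC z) (z 0) (z 2)) := by
    refine contDiff_euclidean.2 fun i => ?_
    fin_cases i
    · exact re (hh.mul ((contDiff_const.mul (hc 0)).mul (hc 2)))
    · exact re (hh.mul (((hc 0).mul (hc 0)).sub ((hc 2).mul (hc 2))))
    · exact re (hh.mul (contDiff_const.mul (((hc 0).mul (hc 0)).add ((hc 2).mul (hc 2)))))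
  exact (hi.smul h1.contDiffAt).prodMk (hi.smul h2.contDiffAt)

lemma contMDiffOn_sphereMap : ContMDiffOn 𝓘(ℝ, Model) 𝓘(ℝ, E3 × E3) ∞ sphereMap uPos := by
  intro x hx
  obtain ⟨z, hz, rfl⟩ := exists_proj_eq x
  exact (contMDiffAt_descend sphereMapC_smul hz
    (contDiffAt_sphereMapC ((proj_mem_uPos hz).1 hx)).contMDiffAt).contMDiffWithinAt

/-- Where `u > 0`, a level set is the image of a smooth section of the map to the tangent bundle
of the sphere. -/
theorem exists_section {f₀ : ℂ} {b : ℝ} (h : f₀ ≠ 0 ∨ 0 < b) :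
    ∃ g : TangentBundle (𝓡 2) S2 → Cone, ContMDiff (𝓡 2).tangent 𝓘(ℝ, Model) ∞ g ∧
      (∀ p, g p ∈ uPos) ∧ (∀ p, sphereMap (g p) = inclTS2 p) ∧
      Set.range g = {x | fPlus x = f₀ ∧ bFun x = b} := by
  have hpos (ξ : E3) : 0 < ‖f₀‖ ^ 2 + ‖ξ‖ ^ 2 ∨ 0 < b := by
    refine h.imp_left fun h => ?_
    have := norm_pos_iff.2 h
    positivity
  have hex (p : TangentBundle (𝓡 2) S2) : ∃ z : C4, 0 < uC z ∧ fC z = f₀ ∧ bC z = b ∧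
      sphereMapC z = inclTS2 p := by
    obtain ⟨A₀, A₁, V, -, hpV, -, -, hA⟩ := exists_spinor (inclTS2 p).1
    exact ⟨_, liftC_spec (norm_inclTS2_fst p) (inner_inclTS2 p)
      (hA _ hpV (norm_inclTS2_fst p)) (hpos _)⟩
  -- The chosen lifts need not vary continuously. Their classes in the cone do, since by separation
  -- of points they agree locally with lifts along a smooth spinor.
  choose l hl hlf hlb hls using hex
  have hl0 (p) : l p ≠ 0 := ne_zero_of_uC_pos (hl p)
  refine ⟨fun p => proj (l p), fun p => ?_, fun p => (proj_mem_uPos (hl0 p)).2 (hl p), fun p => ?_,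
    Set.eq_of_subset_of_subset ?_ ?_⟩
  · obtain ⟨A₀, A₁, V, hV, hpV, h0, h1, hA⟩ := exists_spinor (inclTS2 p).1
    have hspec (q) (hq : (inclTS2 q).1 ∈ V) := liftC_spec (f₀ := f₀) (b := b) (norm_inclTS2_fst q)
      (inner_inclTS2 q) (hA _ hq (norm_inclTS2_fst q)) (hpos _)
    have hsm := contDiffAt_liftC (hpos _) (h0.contDiffAt (hV.mem_nhds hpV))
      (h1.contDiffAt (hV.mem_nhds hpV))
    have hcomp := (contMDiffAt_proj (ne_zero_of_uC_pos (hspec p hpV).1)).comp p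
      (hsm.contMDiffAt.comp p (contMDiff_inclTS2 p))
    refine hcomp.congr_of_eventuallyEq ?_
    have hcont : ContinuousAt (fun q => (inclTS2 q).1) p :=
      (continuous_fst.comp contMDiff_inclTS2.continuous).continuousAt
    filter_upwards [hcont.preimage_mem_nhds (hV.mem_nhds hpV)] with q hq
    obtain ⟨k1, k2, k3, k4⟩ := hspec q hq
    exact proj_eq_of_sphereMapC_eq (hl q) k1 ((hlf q).trans k2.symm) ((hlb q).trans k3.symm)
      ((hls q).trans k4.symm)
  · rw [sphereMap_proj (hl0 p), hls]
  · rintro _ ⟨p, rfl⟩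
    exact ⟨(fPlus_proj (hl0 p)).trans (hlf p), (bFun_proj (hl0 p)).trans (hlb p)⟩
  · rintro x ⟨hxf, hxb⟩
    obtain ⟨z, hz, rfl⟩ := exists_proj_eq x
    rw [fPlus_proj hz] at hxf
    rw [bFun_proj hz] at hxb
    have hu := uC_pos_of_level h hxf hxb
    obtain ⟨p, hp⟩ := exists_inclTS2_eq (norm_sphereMapC_fst hu) (inner_sphereMapC z)
    exact ⟨p, proj_eq_of_sphereMapC_eq (hl p) hu ((hlf p).trans hxf.symm)
      ((hlb p).trans hxb.symm) ((hls p).trans hp)⟩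

/-! ### The involution -/

lemma fC_swapC (z : C4) : fC (swapC z) = -fC z := by
  simp [fC, swapC]

lemma bC_swapC (z : C4) : bC (swapC z) = -bC z := by
  rw [bC, bC, uC_swapC, vC_swapC]
  ring

lemma swapC_swapC (z : C4) : swapC (swapC z) = z := by
  ext i
  fin_cases i <;> simp [swapC]

lemma swapC_ne_zero {z : C4} (hz : z ≠ 0) : swapC z ≠ 0 := fun h => hz <| by
  rw [← swapC_swapC z, h]
  ext i
  fin_cases i <;> simp [swapC]

lemma contDiff_swapC : ContDiff ℝ ∞ swapC := by
  refine contDiff_pi.2 fun i => ?_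
  fin_cases i <;> exact contDiff_conj_coord _

lemma swapC_smul (c : Circle) (z : C4) :
    swapC ((c : ℂ) • z) = ((c⁻¹ : Circle) : ℂ) • swapC z := by
  ext i
  rw [Circle.coe_inv_eq_conj]
  fin_cases i <;> simp [swapC]

lemma proj_swapC_smul (c : Circle) (z : C4) :
    proj (swapC ((c : ℂ) • z)) = proj (swapC z) := by
  by_cases hz : z = 0
  · rw [hz, smul_zero]
  · rw [swapC_smul, proj_smul _ _ (swapC_ne_zero hz)]

/-- The involution of the cone exchanging `u` and `v`. -/
def swap : Cone → Cone := descend (fun z => proj (swapC z)) proj_swapC_smul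

lemma swap_proj {z : C4} (hz : z ≠ 0) : swap (proj z) = proj (swapC z) :=
  descend_proj _ _ hz

lemma swap_swap (x : Cone) : swap (swap x) = x := by
  obtain ⟨z, hz, rfl⟩ := exists_proj_eq x
  rw [swap_proj hz, swap_proj (swapC_ne_zero hz), swapC_swapC]

lemma fPlus_swap (x : Cone) : fPlus (swap x) = -fPlus x := by
  obtain ⟨z, hz, rfl⟩ := exists_proj_eq x
  rw [swap_proj hz, fPlus_proj hz, fPlus_proj (swapC_ne_zero hz), fC_swapC]

lemma bFun_swap (x : Cone) : bFun (swap x) = -bFun x := by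
  obtain ⟨z, hz, rfl⟩ := exists_proj_eq x
  rw [swap_proj hz, bFun_proj hz, bFun_proj (swapC_ne_zero hz), bC_swapC]

lemma contMDiff_swap : ContMDiff 𝓘(ℝ, Model) 𝓘(ℝ, Model) ∞ swap := by
  intro x
  obtain ⟨z, hz, rfl⟩ := exists_proj_eq x
  exact contMDiffAt_descend proj_swapC_smul hz
    ((contMDiffAt_proj (swapC_ne_zero hz)).comp z contDiff_swapC.contDiffAt.contMDiffAt)

/-- In the remaining case f₀ = 0 and b < 0, u may vanish on the level set. The involution exchanges
it with the level set of (-f₀, -b), where u > 0. -/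
theorem isDiffeomorphicToTS2_level {f₀ : ℂ} {b : ℝ} (h : f₀ ≠ 0 ∨ b ≠ 0) :
    IsDiffeomorphicToTS2 {x | fPlus x = f₀ ∧ bFun x = b} := by
  by_cases h' : f₀ ≠ 0 ∨ 0 < b
  · obtain ⟨g, hg, hgV, hLg, hr⟩ := exists_section h'
    exact ⟨g, isSmoothEmbedding_of_comp_eq_inclTS2 hg isOpen_uPos contMDiffOn_sphereMap hgV hLg, hr⟩
  · push Not at h'
    have hb : 0 < -b := by
      have := h.resolve_left (not_not.2 h'.1)
      exact neg_pos.2 (lt_of_le_of_ne h'.2 this)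
    obtain ⟨g, hg, hgV, hLg, hr⟩ := exists_section (f₀ := -f₀) (Or.inr hb)
    refine ⟨swap ∘ g, isSmoothEmbedding_of_comp_eq_inclTS2 (L := sphereMap ∘ swap)
      (V := swap ⁻¹' uPos) (contMDiff_swap.comp hg) (isOpen_uPos.preimage contMDiff_swap.continuous)
      (contMDiffOn_sphereMap.comp contMDiff_swap.contMDiffOn fun x hx => hx)
      (fun p => ?_) (fun p => ?_), ?_⟩
    · rw [Set.mem_preimage, Function.comp_apply, swap_swap]
      exact hgV p
    · rw [Function.comp_apply, Function.comp_apply, swap_swap, hLg]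
    · rw [Set.range_comp, hr]
      ext x
      constructor
      · rintro ⟨y, ⟨h1, h2⟩, rfl⟩
        exact ⟨by rw [fPlus_swap, h1, neg_neg], by rw [bFun_swap, h2, neg_neg]⟩
      · rintro ⟨h1, h2⟩
        exact ⟨swap x, ⟨by rw [fPlus_swap, h1], by rw [bFun_swap, h2]⟩, swap_swap x⟩

end G2Cone

end

theorem theorem6p5 (a b t : ℝ) (ha : 0 ≤ a) (ht : t ∈ Set.Ico 0 (2 * Real.pi)) :
    (G2Cone.levelSet a b t).Nonempty ∧ G2Cone.IsCoassociative (G2Cone.levelSet a b t) ∧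
      (¬ (a = 0 ∧ b = 0) → G2Cone.IsDiffeomorphicToTS2 (G2Cone.levelSet a b t)) := by
  rw [G2Cone.levelSet_eq ha ht]
  refine ⟨G2Cone.nonempty_level _ _, G2Cone.isCoassociative_level _ _, fun hab =>
    G2Cone.isDiffeomorphicToTS2_level ?_⟩
  by_contra! h
  refine hab ⟨?_, h.2⟩
  have h1 := G2Cone.norm_levelValue a t
  rw [h.1, norm_zero, eq_comm, Real.sqrt_eq_zero (by positivity)] at h1
  linarith
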